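/- Let $\ell:\mathbb{R}\to\mathbb{C}$ satisfy $\operatorname{Re}\ell(k)\le 0$ for all $k\in\mathbb{R}$ and $\ell(0)=0$, and let $\mathcal{L}$ be the Fourier multiplier $\widehat{\mathcal{L}v}(k)=\ell(k)\hat v(k)$. For functions $f$ with $f'\in L^2(\mathbb{R})$ and images $\mathcal{L}f\in L^2(\mathbb{R})$ this is understood as $ik\,\widehat{\mathcal{L}f}(k)=\ell(k)\,\widehat{f'}(k)$ for a.e. $k$. Consider the Burgers-type equation $$u_t+uu_x=u_{xx}+\mathcal{L}u,\qquad u(\cdot,0)=u_0,\qquad x\in\mathbb{R},\ t\ge 0,$$ for real-valued $u$. Let $\phi:\mathbb{R}\to\mathbb{R}$ be a stationary front: $\phi\in H^2_{\mathrm{loc}}(\mathbb{R})$, $\phi\phi'=\phi''+\mathcal{L}\phi$, $\phi(x)\to\mp1$ as $x\to\pm\infty$, $\phi',\phi''\in L^2(\mathbb{R})$, and $\int_{-\infty}^{\infty}(1+|x|)|\phi'(x)|\,dx<\infty$. For a real-valued function $q$ with $q^-=\max(-q,0)$ put $$\tau(q)=\max_{x_0\in\mathbb{R}}\min\left(\int_{-\infty}^{x_0}(x_0-x)q^-(x)\,dx,\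 \int_{x_0}^{\infty}(x-x_0)q^-(x)\,dx\right).$$ If $\phi$ is sharp, that is, $\tau(\tfrac12\phi')<1$, then $\phi$ is nonlinearly (orbitally) asymptotically stable in the following sense. For every global solution $u$ of the initial value problem in the class $$u-\phi\in C([0,\infty);L^2(\mathbb{R}))\cap C((0,\infty);H^2(\mathbb{R}))\cap C^1((0,\infty);L^2(\mathbb{R}))$$ there is a function $x_0(t)$ such that $u(\cdot,t)-\phi(\cdot-x_0(t))\in L^2(\mathbb{R})$ for all $t>0$, the function $t\mapsto\|u(\cdot,t)-\phi(\cdot-x_0(t))\|_{L^2(\mathbb{R})}^2$ is differentiable on $(0,\infty)$ with $$\frac{d}{dt}\|u(\cdot,t)-\phi(\cdot-x_0(t))\|_{L^2(\mathbb{R})}^2\le 0\quad\text{for all }t>0,$$ $$\|u_x(\cdot,t)-\phi'(\cdot-x_0(t))\|_{L^2(\mathbb{R})}^2\to 0\quad\text{as }t\to\infty,$$ and, for every $p\in(2,\infty]$, $$\|u(\cdot,t)-\phi(\cdot-x_0(t))\|_{L^p(\mathbb{R})}\to 0\quad\text{as }t\to\infty.$$ -/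

import Mathlib

open MeasureTheory Filter Topology Set
open scoped FourierTransform ENNReal

noncomputable section

namespace BurgersFront

/-- `f ∈ H²_loc(ℝ)`: `f` is continuously differentiable and `f'` is locally absolutely continuous.
Then `f'' = deriv (deriv f)` exists almost everywhere and is the weak second derivative. -/
def IsH2Loc (f : ℝ → ℝ) : Prop :=
  ContDiff ℝ 1 f ∧ ∀ a b : ℝ, AbsolutelyContinuousOnInterval (deriv f) a b

/-- `ℒ f = g`, where `ℒ` is the Fourier multiplier with symbol `ℓ(k)`, for functions `f` with
`f' ∈ L²` (so that fronts, which are not in `L²`, are allowed) and an image `g ∈ L²`.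
Away from the frequency `k = 0` the relation `ĝ(k) = ℓ(k) f̂(k)` is the same as
`i k ĝ(k) = ℓ(k) (f')^(k)`, which is what is required for almost every `k`; constants are
annihilated, in accordance with `ℓ(0) = 0`.
The Fourier transform is the one on `L²`, with `(𝓕 h)(ξ) = ∫ h(x) exp(-2πi x ξ) dx`, so
the frequency is `k = 2πξ`. -/
def IsMultiplierImage (ℓ : ℝ → ℂ) (f g : ℝ → ℝ) : Prop :=
  ContDiff ℝ 1 f ∧
  ∃ F G : Lp ℂ 2 (volume : Measure ℝ),
    (F =ᵐ[volume] fun x => ((deriv f x : ℝ) : ℂ)) ∧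
    (G =ᵐ[volume] fun x => ((g x : ℝ) : ℂ)) ∧
    ∀ᵐ ξ : ℝ, Complex.I * ((2 * Real.pi * ξ : ℝ) : ℂ) * (𝓕 G : Lp ℂ 2 (volume : Measure ℝ)) ξ
      = ℓ (2 * Real.pi * ξ) * (𝓕 F : Lp ℂ 2 (volume : Measure ℝ)) ξ

/-- `φ` is a (stationary) traveling front: `φ φ' = φ'' + ℒ φ`, `φ(x) → ∓1` as `x → ±∞`, with
`φ', φ'' ∈ L²`. -/
structure IsFront (ℓ : ℝ → ℂ) (φ : ℝ → ℝ) : Prop where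
  isH2Loc : IsH2Loc φ
  memLp_deriv : MemLp (deriv φ) 2 volume
  memLp_deriv_deriv : MemLp (deriv (deriv φ)) 2 volume
  tendsto_atTop : Tendsto φ atTop (𝓝 (-1))
  tendsto_atBot : Tendsto φ atBot (𝓝 1)
  equation : ∃ Lφ : ℝ → ℝ, IsMultiplierImage ℓ φ Lφ ∧
    ∀ᵐ x : ℝ, φ x * deriv φ x = deriv (deriv φ) x + Lφ x

/-- Bargmann's functional
`τ(q) = max_{x₀} min (∫_{-∞}^{x₀} (x₀ - x) q⁻(x) dx, ∫_{x₀}^∞ (x - x₀) q⁻(x) dx)`,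
`q⁻ = max (-q, 0)`, as an extended nonnegative number. -/
def tau (q : ℝ → ℝ) : ℝ≥0∞ :=
  ⨆ x₀ : ℝ, min
    (∫⁻ x in Iic x₀, ENNReal.ofReal ((x₀ - x) * max (-q x) 0))
    (∫⁻ x in Ici x₀, ENNReal.ofReal ((x - x₀) * max (-q x) 0))

/-- `u` (with `u t x` the value at time `t` and position `x`) is a global solution of
`u_t + u u_x = u_xx + ℒ u`, `u(·,0) = u₀`, in the Sobolev class
`u - φ ∈ C([0,∞); L²) ∩ C((0,∞); H²) ∩ C¹((0,∞); L²)`. Here `w = u - φ` as a curve in `L²`,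
`wxx = u_xx - φ''`, and `ut = u_t = w_t` is the time derivative in `L²`. -/
def IsGlobalSolution (ℓ : ℝ → ℂ) (φ u₀ : ℝ → ℝ) (u : ℝ → ℝ → ℝ) : Prop :=
  u 0 = u₀ ∧
  (∀ t : ℝ, 0 < t → IsH2Loc (u t)) ∧
  ∃ w wxx ut : ℝ → Lp ℝ 2 (volume : Measure ℝ),
    (∀ t : ℝ, 0 ≤ t → w t =ᵐ[volume] fun x => u t x - φ x) ∧
    (∀ t : ℝ, 0 < t →
      wxx t =ᵐ[volume] fun x => deriv (deriv (u t)) x - deriv (deriv φ) x) ∧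
    ContinuousOn w (Ici 0) ∧
    ContinuousOn wxx (Ioi 0) ∧
    ContinuousOn ut (Ioi 0) ∧
    (∀ t : ℝ, 0 < t → HasDerivAt w (ut t) t) ∧
    ∀ t : ℝ, 0 < t → ∃ Lu : ℝ → ℝ, IsMultiplierImage ℓ (u t) Lu ∧
      ∀ᵐ x : ℝ, ut t x + u t x * deriv (u t) x = deriv (deriv (u t)) x + Lu x

/-- Nonlinear (orbital) asymptotic stability of the front `φ`: for every global solution `u`
(with no smallness assumption) there is a translation `x₀(t)` such that
`‖u(·,t) - φ(· - x₀(t))‖²_{L²}` has a nonpositive time derivative at every `t > 0`,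
`‖u_x(·,t) - φ'(· - x₀(t))‖²_{L²} → 0`, and
`‖u(·,t) - φ(· - x₀(t))‖_{L^p} → 0` for all `2 < p ≤ ∞`, as `t → ∞`. -/
def IsAsymptoticallyStable (ℓ : ℝ → ℂ) (φ : ℝ → ℝ) : Prop :=
  ∀ (u₀ : ℝ → ℝ) (u : ℝ → ℝ → ℝ), IsGlobalSolution ℓ φ u₀ u →
    ∃ x₀ : ℝ → ℝ,
      (∀ t : ℝ, 0 < t → MemLp (fun x => u t x - φ (x - x₀ t)) 2 volume) ∧
      (∀ t : ℝ, 0 < t → ∃ d : ℝ, d ≤ 0 ∧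
        HasDerivAt (fun s : ℝ => ∫ x : ℝ, (u s x - φ (x - x₀ s)) ^ 2) d t) ∧
      Tendsto (fun t : ℝ =>
        (eLpNorm (fun x => deriv (u t) x - deriv φ (x - x₀ t)) 2 volume) ^ 2) atTop (𝓝 0) ∧
      ∀ p : ℝ≥0∞, 2 < p →
        Tendsto (fun t : ℝ => eLpNorm (fun x => u t x - φ (x - x₀ t)) p volume) atTop (𝓝 0)

end BurgersFront

end

/-! The perturbation of the moving front is measured by v = u - ψ with ψ = φ(· - x₀(t)), and the
phase is steered by x₀' = -¼ ∫ ψ' v. Testing the equation for v with v, the cubic term integrates to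
zero, ℒ contributes a nonpositive amount because Re ℓ ≤ 0, and the motion of the phase contributes a
square: ½ d/dt ‖v‖² ≤ -(‖v_x‖² + ½ ∫ ψ' v² + ¼ (∫ ψ' v)²).

Sharpness makes the form on the right coercive (`exists_coercive_of_tau_lt_one`). Since q = ½ φ' has
mass -1, ∫ q v² + (∫ q v)² is unchanged when a constant is subtracted from v. So v may be made to
vanish at the point where the two one-sided first moments of q⁻ agree. Bargmann's bound z(x)² ≤ |x -
x₀| ∫ z'² then controls ∫ q⁻ z² by M ∫ z'², where the common moment M is at most τ(q) < 1. Hence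
d/dt ‖v‖² ≤ -2κ ‖v_x‖² with κ = 1 - M > 0, for perturbations of any size.

The squared norm y = ‖v_x‖² satisfies y' ≤ C (1 + y)², because ℒ is also dissipative for the
gradient and the remaining terms are absorbed by ‖v_xx‖²
(`IsH2.neg_integral_deriv_deriv_mul_perturbationField_le`). Together with the dissipation of ‖v‖² a
Barbalat argument gives y → 0 (`tendsto_zero_of_lyapunov_of_le_sq`). Agmon's inequality turns this
into uniform decay, and interpolation with the bounded L² norm gives every p > 2.

Two technical points: φ is not in L², so all L² calculus rests on the increments φ - φ(· - a)
(`LocallyAC.hasDerivAt_increment`); and v_xx is only continuous in time, so y is differentiated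
through the symmetry of ∂ₓ² (`hasDerivAt_neg_inner_of_symm`). -/

noncomputable section

namespace BurgersFront

/-! ### Absolutely continuous functions on the line -/

/-- `f` is absolutely continuous on every bounded interval. -/
def LocallyAC (f : ℝ → ℝ) : Prop := ∀ a b : ℝ, AbsolutelyContinuousOnInterval f a b

theorem LocallyAC.of_contDiff {f : ℝ → ℝ} (hf : ContDiff ℝ 1 f) : LocallyAC f :=
  fun _ _ => hf.contDiffOn.absolutelyContinuousOnInterval

theorem LocallyAC.continuous {f : ℝ → ℝ} (hf : LocallyAC f) : Continuous f := by
  rw [continuous_iff_continuousAt]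
  intro x
  have h := (hf (x - 1) (x + 1)).continuousOn
  rw [uIcc_of_le (by linarith)] at h
  exact h.continuousAt (Icc_mem_nhds (by linarith) (by linarith))

theorem LocallyAC.ae_differentiableAt {f : ℝ → ℝ} (hf : LocallyAC f) :
    ∀ᵐ x : ℝ, DifferentiableAt ℝ f x := by
  have h : ∀ᵐ x : ℝ, ∀ n : ℕ, x ∈ uIcc (-(n : ℝ)) n → DifferentiableAt ℝ f x :=
    ae_all_iff.2 fun n => (hf (-(n : ℝ)) n).ae_differentiableAt
  filter_upwards [h] with x hx
  obtain ⟨n, hn⟩ := exists_nat_ge |x|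
  refine hx n ?_
  rw [uIcc_of_le (by linarith [abs_nonneg x])]
  exact ⟨by linarith [neg_abs_le x], by linarith [le_abs_self x]⟩

theorem LocallyAC.sub {f g : ℝ → ℝ} (hf : LocallyAC f) (hg : LocallyAC g) :
    LocallyAC (fun x => f x - g x) := fun a b => (hf a b).fun_sub (hg a b)

theorem LocallyAC.comp_sub_const {f : ℝ → ℝ} (hf : LocallyAC f) (c : ℝ) :
    LocallyAC (fun x => f (x - c)) := by
  intro a b
  have h := hf (a - c) (b - c)
  rw [absolutelyContinuousOnInterval_iff] at h ⊢
  intro ε hε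
  obtain ⟨δ, hδ, H⟩ := h ε hε
  refine ⟨δ, hδ, fun E hE hlen => ?_⟩
  refine H (E.1, fun i => ((E.2 i).1 - c, (E.2 i).2 - c)) ?_ (by simpa using hlen)
  obtain ⟨h1, h2⟩ := hE
  refine ⟨fun i hi => ?_, ?_⟩
  · have := h1 i hi
    have key : ∀ {y : ℝ}, y ∈ uIcc a b → y - c ∈ uIcc (a - c) (b - c) := by
      intro y hy
      rw [← Set.image_sub_const_uIcc]
      exact mem_image_of_mem _ hy
    exact ⟨key this.1, key this.2⟩
  · intro i hi j hj hij
    have := h2 hi hj hij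
    simp only [Function.onFun] at this ⊢
    rw [Set.disjoint_left] at this ⊢
    intro y hy hy'
    simp only [mem_uIoc] at this hy hy'
    exact this (a := y + c) (by grind) (by grind)

/-- Integration by parts on the line. -/
theorem LocallyAC.integral_deriv_mul {f g : ℝ → ℝ} (hf : LocallyAC f) (hg : LocallyAC g)
    (h0 : Integrable fun x => f x * g x) (h1 : Integrable fun x => deriv f x * g x)
    (h2 : Integrable fun x => f x * deriv g x) :
    ∫ x, deriv f x * g x = -∫ x, f x * deriv g x := by
  have hlim : Tendsto (fun R : ℝ => f R * g R - f (-R) * g (-R)) atTop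
      (𝓝 (∫ x, (deriv f x * g x + f x * deriv g x))) := by
    have := intervalIntegral_tendsto_integral (h1.add h2) tendsto_neg_atTop_atBot tendsto_id
    refine this.congr fun R => ?_
    simpa using AbsolutelyContinuousOnInterval.integral_deriv_mul_eq_sub (hf (-R) R) (hg (-R) R)
  -- The boundary term is itself an integrable function of R and has a limit, so the limit must be
  -- 0. No separate decay of f or g is needed.
  have hint : Integrable (fun R : ℝ => f R * g R - f (-R) * g (-R)) :=
    h0.sub h0.comp_neg
  have := IntegrableAtFilter.eq_zero_of_tendsto (μ := volume)
    (⟨univ, univ_mem, hint.integrableOn⟩ : IntegrableAtFilter _ atTop _) (fun s hs => by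
      rcases mem_atTop_sets.1 hs with ⟨b, hb⟩
      rw [← top_le_iff, ← Real.volume_Ici (a := b)]
      exact measure_mono hb) hlim
  rw [integral_add h1 h2] at this
  linarith

theorem LocallyAC.integral_deriv_mul_of_memLp {f g : ℝ → ℝ} (hf : LocallyAC f) (hg : LocallyAC g)
    (f0 : MemLp f 2) (g0 : MemLp g 2) (f1 : MemLp (deriv f) 2) (g1 : MemLp (deriv g) 2) :
    ∫ x, deriv f x * g x = -∫ x, f x * deriv g x :=
  hf.integral_deriv_mul hg (f0.integrable_mul g0) (f1.integrable_mul g0) (f0.integrable_mul g1)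

/-- Agmon's inequality on the line, in additive form. -/
theorem sq_le_mul_integral_sq_add {v : ℝ → ℝ} (hv : ContDiff ℝ 1 v) (v0 : MemLp v 2)
    (v1 : MemLp (deriv v) 2) {ε : ℝ} (hε : 0 < ε) (x : ℝ) :
    v x ^ 2 ≤ ε * (∫ y, v y ^ 2) + ε⁻¹ * ∫ y, deriv v y ^ 2 := by
  have hd : ∀ y, HasDerivAt (fun y => v y ^ 2) (2 * v y * deriv v y) y := fun y => by
    simpa using ((hv.differentiable (by norm_num)).differentiableAt (x := y)).hasDerivAt.fun_pow 2
  have hi : Integrable fun y => v y ^ 2 := v0.integrable_sq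
  have hi1 : Integrable fun y => deriv v y ^ 2 := v1.integrable_sq
  have hi2 : Integrable fun y => 2 * v y * deriv v y := by
    simpa [mul_assoc] using (v0.integrable_mul v1).const_mul 2
  have hz := tendsto_zero_of_hasDerivAt_of_integrableOn_Iic (a := x) (fun y _ => hd y)
    hi2.integrableOn hi.integrableOn
  have h1 := integral_Iic_of_hasDerivAt_of_tendsto' (a := x) (fun y _ => hd y)
    hi2.integrableOn hz
  have hg : Integrable fun y => ε * v y ^ 2 + ε⁻¹ * deriv v y ^ 2 :=
    (hi.const_mul ε).add (hi1.const_mul _)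
  calc v x ^ 2 = ∫ y in Iic x, 2 * v y * deriv v y := by rw [h1]; ring
    _ ≤ ∫ y in Iic x, (ε * v y ^ 2 + ε⁻¹ * deriv v y ^ 2) := by
      refine integral_mono hi2.integrableOn hg.integrableOn fun y => ?_
      have h : 0 ≤ ε⁻¹ * (ε * v y - deriv v y) ^ 2 := by positivity
      have e : ε⁻¹ * (ε * v y - deriv v y) ^ 2
          = ε * v y ^ 2 + ε⁻¹ * deriv v y ^ 2 - 2 * v y * deriv v y := by
        field_simp
        ring
      simp only
      linarith
    _ ≤ ∫ y, (ε * v y ^ 2 + ε⁻¹ * deriv v y ^ 2) :=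
      setIntegral_le_integral hg (Eventually.of_forall fun y => by positivity)
    _ = _ := by
      rw [integral_add (hi.const_mul ε) (hi1.const_mul _), integral_const_mul, integral_const_mul]

theorem sq_le_integral_sq_add {v : ℝ → ℝ} (hv : ContDiff ℝ 1 v) (v0 : MemLp v 2)
    (v1 : MemLp (deriv v) 2) (x : ℝ) :
    v x ^ 2 ≤ (∫ y, v y ^ 2) + ∫ y, deriv v y ^ 2 := by
  simpa using sq_le_mul_integral_sq_add hv v0 v1 one_pos x

/-! ### Coercivity of the linearized energy for sharp fronts -/

/-- Cauchy–Schwarz against the constant 1, read off from ∫ (l - f)² ≥ 0 with l the mean of f over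
the interval. -/
theorem sq_integral_Ioc_le {f : ℝ → ℝ} (hf : MemLp f 2) {a b : ℝ} (hab : a ≤ b) :
    (∫ x in Ioc a b, f x) ^ 2 ≤ (b - a) * ∫ x in Ioc a b, f x ^ 2 := by
  rcases hab.eq_or_lt with rfl | hab
  · simp
  have h2 : IntegrableOn (fun x => f x ^ 2) (Ioc a b) := hf.integrable_sq.integrableOn
  have h1 : IntegrableOn f (Ioc a b) :=
    (hf.locallyIntegrable (by norm_num)).integrableOn_isCompact isCompact_Icc |>.mono_set
      Ioc_subset_Icc_self
  set I := ∫ x in Ioc a b, f x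
  have hpos : 0 < b - a := sub_pos.2 hab
  set l := I / (b - a)
  have h0 : 0 ≤ ∫ x in Ioc a b, (l - f x) ^ 2 := integral_nonneg fun x => sq_nonneg _
  have hc : IntegrableOn (fun _ => l ^ 2) (Ioc a b) := by simp
  have e : ∫ x in Ioc a b, (l - f x) ^ 2
      = l ^ 2 * (b - a) - 2 * l * I + ∫ x in Ioc a b, f x ^ 2 := by
    have : (fun x => (l - f x) ^ 2) = fun x => l ^ 2 - 2 * l * f x + f x ^ 2 := by
      ext x; ring
    have hs : IntegrableOn (fun x => l ^ 2 - 2 * l * f x) (Ioc a b) := hc.sub (h1.const_mul _)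
    rw [this, integral_add hs h2, integral_sub hc (h1.const_mul _),
      integral_const_mul]
    simp [hab.le, mul_comm, I]
  have hl : l * (b - a) = I := div_mul_cancel₀ _ hpos.ne'
  rw [e] at h0
  have : (b - a) * (l ^ 2 * (b - a) - 2 * l * I) = -I ^ 2 := by
    rw [← hl]; ring
  nlinarith [mul_nonneg hpos.le h0]

theorem sq_sub_le_mul_integral {z : ℝ → ℝ} (hz : ContDiff ℝ 1 z) (z1 : MemLp (deriv z) 2)
    {a b : ℝ} (hab : a ≤ b) : (z b - z a) ^ 2 ≤ (b - a) * ∫ x in Ioc a b, deriv z x ^ 2 := by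
  have h := (LocallyAC.of_contDiff hz a b).integral_deriv_eq_sub
  rw [intervalIntegral.integral_of_le hab] at h
  rw [← h]
  exact sq_integral_Ioc_le z1 hab

/-- Bargmann's estimate on both sides of a zero of `z`. -/
theorem integral_weight_mul_sq_le {p z : ℝ → ℝ} (hp : ∀ x, 0 ≤ p x) {x₀ : ℝ}
    (hz : ContDiff ℝ 1 z) (z1 : MemLp (deriv z) 2) (hz0 : z x₀ = 0)
    (hpz : Integrable fun x => p x * z x ^ 2) (hpx : Integrable fun x => (x - x₀) * p x) :
    ∫ x, p x * z x ^ 2 ≤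
      (∫ x in Iic x₀, (x₀ - x) * p x) * (∫ x in Iic x₀, deriv z x ^ 2)
        + (∫ x in Ioi x₀, (x - x₀) * p x) * (∫ x in Ioi x₀, deriv z x ^ 2) := by
  have hi : Integrable fun x => deriv z x ^ 2 := z1.integrable_sq
  have hpx' : Integrable fun x => (x₀ - x) * p x := by
    refine hpx.neg.congr (Eventually.of_forall fun x => ?_)
    simp only [Pi.neg_apply]; ring
  rw [← integral_add_compl measurableSet_Iic hpz, compl_Iic, ← integral_mul_const,
    ← integral_mul_const]
  refine add_le_add ?_ ?_
  · refine setIntegral_mono_on hpz.integrableOn (hpx'.integrableOn.mul_const _)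
      measurableSet_Iic fun x hx => ?_
    have h := sq_sub_le_mul_integral hz z1 (mem_Iic.1 hx)
    have h' : ∫ y in Ioc x x₀, deriv z y ^ 2 ≤ ∫ y in Iic x₀, deriv z y ^ 2 :=
      setIntegral_mono_set hi.integrableOn (Eventually.of_forall fun y => sq_nonneg _)
        Ioc_subset_Iic_self.eventuallyLE
    have h'' := mul_le_mul_of_nonneg_left h' (sub_nonneg.2 (mem_Iic.1 hx))
    rw [hz0] at h
    nlinarith [mul_le_mul_of_nonneg_left (h.trans h'') (hp x)]
  · refine setIntegral_mono_on hpz.integrableOn (hpx.integrableOn.mul_const _)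
      measurableSet_Ioi fun x hx => ?_
    have h := sq_sub_le_mul_integral hz z1 (mem_Ioi.1 hx).le
    have h' : ∫ y in Ioc x₀ x, deriv z y ^ 2 ≤ ∫ y in Ioi x₀, deriv z y ^ 2 :=
      setIntegral_mono_set hi.integrableOn (Eventually.of_forall fun y => sq_nonneg _)
        Ioc_subset_Ioi_self.eventuallyLE
    have h'' := mul_le_mul_of_nonneg_left h' (sub_nonneg.2 (mem_Ioi.1 hx).le)
    rw [hz0] at h
    nlinarith [mul_le_mul_of_nonneg_left (h.trans h'') (hp x)]

/-- The two one-sided first moments of `p` agree at the center of mass of `p`. -/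
theorem exists_moments_eq {p : ℝ → ℝ} (h0 : Integrable p) (h1 : Integrable fun x => x * p x)
    (hm : 0 < ∫ x, p x) :
    ∃ x₀ : ℝ, ∫ x in Iic x₀, (x₀ - x) * p x = ∫ x in Ioi x₀, (x - x₀) * p x := by
  refine ⟨(∫ x, x * p x) / ∫ x, p x, ?_⟩
  set x₀ := (∫ x, x * p x) / ∫ x, p x
  have hi : Integrable fun x => (x₀ - x) * p x := by
    refine ((h0.const_mul x₀).sub h1).congr (Eventually.of_forall fun x => ?_)
    simp only [Pi.sub_apply]; ring
  have h : ∫ x, (x₀ - x) * p x = 0 := by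
    have : ∀ x, (x₀ - x) * p x = x₀ * p x - x * p x := fun x => by ring
    simp_rw [this]
    rw [integral_sub (h0.const_mul x₀) h1, integral_const_mul]
    have : x₀ * ∫ x, p x = ∫ x, x * p x := div_mul_cancel₀ _ hm.ne'
    rw [this, sub_self]
  rw [← integral_add_compl (s := Iic x₀) measurableSet_Iic hi, compl_Iic] at h
  have e : ∫ x in Ioi x₀, (x - x₀) * p x = -∫ x in Ioi x₀, (x₀ - x) * p x := by
    rw [← integral_neg]
    exact integral_congr_ae (Eventually.of_forall fun x => by simp only; ring)
  rw [e]
  linarith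

/-- Where the two moments of q⁻ coincide, the minimum inside `tau` is their common value, so the
bound on the supremum applies to both sides at once. Negative mass of q ensures that q⁻ has positive
mass, so that its center exists. -/
theorem exists_moment_lt_one_of_tau_lt_one {q : ℝ → ℝ} (h0 : Integrable q)
    (h1 : Integrable fun x => x * q x) (hq : ∫ x, q x < 0) (hτ : tau q < 1) :
    ∃ x₀ : ℝ, ∫ x in Iic x₀, (x₀ - x) * max (-q x) 0 = ∫ x in Ioi x₀, (x - x₀) * max (-q x) 0 ∧
      ∫ x in Iic x₀, (x₀ - x) * max (-q x) 0 < 1 := by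
  have p0 : Integrable fun x => max (-q x) 0 := h0.neg.pos_part
  have p1 : Integrable fun x => x * max (-q x) 0 := by
    refine h1.mono (aestronglyMeasurable_id.mul p0.aestronglyMeasurable)
      (Eventually.of_forall fun x => ?_)
    simp only [norm_mul, Real.norm_eq_abs]
    refine mul_le_mul_of_nonneg_left ?_ (abs_nonneg _)
    rw [abs_of_nonneg (le_max_right _ _)]
    exact max_le (neg_le_abs _) (abs_nonneg _)
  have hm : 0 < ∫ x, max (-q x) 0 := by
    have : ∫ x, -q x ≤ ∫ x, max (-q x) 0 := integral_mono h0.neg p0 fun x => le_max_left _ _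
    rw [integral_neg] at this
    linarith
  obtain ⟨x₀, hx₀⟩ := exists_moments_eq p0 p1 hm
  refine ⟨x₀, hx₀, ?_⟩
  have i1 : Integrable fun x => (x₀ - x) * max (-q x) 0 := by
    refine ((p0.const_mul x₀).sub p1).congr (Eventually.of_forall fun x => ?_)
    simp only [Pi.sub_apply]; ring
  have i2 : Integrable fun x => (x - x₀) * max (-q x) 0 := by
    refine (p1.sub (p0.const_mul x₀)).congr (Eventually.of_forall fun x => ?_)
    simp only [Pi.sub_apply]; ring
  have e1 : ∫⁻ x in Iic x₀, ENNReal.ofReal ((x₀ - x) * max (-q x) 0)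
      = ENNReal.ofReal (∫ x in Iic x₀, (x₀ - x) * max (-q x) 0) := by
    rw [ofReal_integral_eq_lintegral_ofReal i1.integrableOn]
    filter_upwards [ae_restrict_mem measurableSet_Iic] with x hx
    exact mul_nonneg (sub_nonneg.2 hx) (le_max_right _ _)
  have e2 : ∫⁻ x in Ici x₀, ENNReal.ofReal ((x - x₀) * max (-q x) 0)
      = ENNReal.ofReal (∫ x in Ioi x₀, (x - x₀) * max (-q x) 0) := by
    rw [← integral_Ici_eq_integral_Ioi, ofReal_integral_eq_lintegral_ofReal i2.integrableOn]
    filter_upwards [ae_restrict_mem measurableSet_Ici] with x hx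
    exact mul_nonneg (sub_nonneg.2 hx) (le_max_right _ _)
  have h := (le_iSup (fun x₀ : ℝ => min
    (∫⁻ x in Iic x₀, ENNReal.ofReal ((x₀ - x) * max (-q x) 0))
    (∫⁻ x in Ici x₀, ENNReal.ofReal ((x - x₀) * max (-q x) 0))) x₀).trans_lt hτ
  simp only [e1, e2, ← hx₀, min_self] at h
  rwa [ENNReal.ofReal_lt_one] at h

theorem exists_abs_le_of_memLp {v : ℝ → ℝ} (hv : ContDiff ℝ 1 v) (v0 : MemLp v 2)
    (v1 : MemLp (deriv v) 2) : ∃ C, ∀ x, |v x| ≤ C :=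
  ⟨√((∫ y, v y ^ 2) + ∫ y, deriv v y ^ 2), fun x =>
    Real.abs_le_sqrt (sq_le_integral_sq_add hv v0 v1 x)⟩

theorem _root_.MeasureTheory.Integrable.mul_of_abs_le {f g : ℝ → ℝ} (hf : Integrable f)
    (hg : Continuous g) {C : ℝ} (hC : ∀ x, |g x| ≤ C) : Integrable fun x => f x * g x :=
  hf.mul_bdd (c := C) hg.aestronglyMeasurable (Eventually.of_forall fun x => by simpa using hC x)

/-- If `q` has total mass `-1` and `tau q < 1`, the quadratic form
`v ↦ ∫ v'² + ∫ q v² + (∫ q v)²` controls `∫ v'²`. -/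
theorem exists_coercive_of_tau_lt_one {q : ℝ → ℝ} (h0 : Integrable q)
    (h1 : Integrable fun x => x * q x) (hq : ∫ x, q x = -1) (hτ : tau q < 1) :
    ∃ κ : ℝ, 0 < κ ∧ ∀ v : ℝ → ℝ, ContDiff ℝ 1 v → MemLp v 2 → MemLp (deriv v) 2 →
      κ * ∫ x, deriv v x ^ 2 ≤
        (∫ x, deriv v x ^ 2) + (∫ x, q x * v x ^ 2) + (∫ x, q x * v x) ^ 2 := by
  obtain ⟨x₀, hx₀, hlt⟩ := exists_moment_lt_one_of_tau_lt_one h0 h1 (by linarith) hτ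
  set p : ℝ → ℝ := fun x => max (-q x) 0
  set M := ∫ x in Iic x₀, (x₀ - x) * p x
  refine ⟨1 - M, by linarith, fun v hv v0 v1 => ?_⟩
  obtain ⟨C, hC⟩ := exists_abs_le_of_memLp hv v0 v1
  -- Subtracting the value at the balance point produces the zero that Bargmann's estimate requires.
  set a := v x₀
  set z : ℝ → ℝ := fun x => v x - a
  have hz : ContDiff ℝ 1 z := hv.sub contDiff_const
  have hdz : deriv z = deriv v := by ext x; simp [z]
  have zb : ∀ x, |z x| ≤ C + C := fun x =>
    (abs_sub _ _).trans (add_le_add (hC x) (hC x₀))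
  have zb2 : ∀ x, |z x ^ 2| ≤ (C + C) ^ 2 := fun x => by
    rw [abs_pow]; exact pow_le_pow_left₀ (abs_nonneg _) (zb x) 2
  have p0 : Integrable p := h0.neg.pos_part
  have p1 : Integrable fun x => (x - x₀) * p x := by
    have h2 : Integrable fun x => (x - x₀) * q x := by
      refine (h1.sub (h0.const_mul x₀)).congr (Eventually.of_forall fun x => ?_)
      simp only [Pi.sub_apply]; ring
    refine h2.mono (by
      exact (continuous_id.sub continuous_const).aestronglyMeasurable.mul p0.aestronglyMeasurable)
      (Eventually.of_forall fun x => ?_)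
    simp only [norm_mul, Real.norm_eq_abs]
    refine mul_le_mul_of_nonneg_left ?_ (abs_nonneg _)
    rw [abs_of_nonneg (le_max_right _ _)]
    exact max_le (neg_le_abs _) (abs_nonneg _)
  have iz : Integrable fun x => q x * z x := h0.mul_of_abs_le hz.continuous zb
  have iz2 : Integrable fun x => q x * z x ^ 2 := h0.mul_of_abs_le (hz.continuous.pow 2) zb2
  have ipz2 : Integrable fun x => p x * z x ^ 2 := p0.mul_of_abs_le (hz.continuous.pow 2) zb2
  have z1 : MemLp (deriv z) 2 := by rwa [hdz]
  have key := integral_weight_mul_sq_le (p := p) (fun x => le_max_right _ _) hz z1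
    (sub_self _) ipz2 p1
  have split : (∫ x in Iic x₀, deriv z x ^ 2) + ∫ x in Ioi x₀, deriv z x ^ 2
      = ∫ x, deriv v x ^ 2 := by
    rw [hdz, ← compl_Iic, integral_add_compl measurableSet_Iic v1.integrable_sq]
  change M = ∫ x in Ioi x₀, (x - x₀) * p x at hx₀
  rw [← hx₀, ← mul_add, split] at key
  have hneg : -∫ x, p x * z x ^ 2 ≤ ∫ x, q x * z x ^ 2 := by
    rw [← integral_neg]
    refine integral_mono ipz2.neg iz2 fun x => ?_
    have : -q x ≤ p x := le_max_left _ _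
    simp only
    nlinarith [mul_le_mul_of_nonneg_right this (sq_nonneg (z x))]
  have e1 : ∫ x, q x * v x = (∫ x, q x * z x) - a := by
    have : ∀ x, q x * v x = q x * z x + a * q x := fun x => by simp only [z]; ring
    simp_rw [this]
    rw [integral_add iz (h0.const_mul a), integral_const_mul, hq]
    ring
  have e2 : ∫ x, q x * v x ^ 2 = (∫ x, q x * z x ^ 2) + 2 * a * (∫ x, q x * z x) - a ^ 2 := by
    have : ∀ x, q x * v x ^ 2 = q x * z x ^ 2 + 2 * a * (q x * z x) + a ^ 2 * q x := fun x => by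
      simp only [z]; ring
    simp_rw [this]
    have hs : Integrable fun x => q x * z x ^ 2 + 2 * a * (q x * z x) := iz2.add (iz.const_mul _)
    rw [integral_add hs (h0.const_mul _),
      integral_add iz2 (iz.const_mul _), integral_const_mul, integral_const_mul, hq]
    ring
  -- Because q has mass -1, all terms containing a cancel and ∫ q v² + (∫ q v)² equals ∫ q z² + (∫ q
  -- z)². The last square is nonnegative and is dropped.
  rw [e1, e2]
  nlinarith [sq_nonneg (∫ x, q x * z x)]

/-- The front descends from 1 to -1, so ½ φ' has mass exactly -1. The weight 1 + |x| supplies both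
the integrability of φ' and its first moment. -/
theorem exists_coercive_of_sharp {φ : ℝ → ℝ} (hφ : ContDiff ℝ 1 φ)
    (htop : Tendsto φ atTop (𝓝 (-1))) (hbot : Tendsto φ atBot (𝓝 1))
    (hint : Integrable (fun x : ℝ => (1 + |x|) * deriv φ x))
    (hτ : tau (fun x : ℝ => 1 / 2 * deriv φ x) < 1) :
    Integrable (deriv φ) ∧
    ∃ κ : ℝ, 0 < κ ∧ ∀ v : ℝ → ℝ, ContDiff ℝ 1 v → MemLp v 2 → MemLp (deriv v) 2 →
      κ * ∫ x, deriv v x ^ 2 ≤ (∫ x, deriv v x ^ 2) + 1 / 2 * (∫ x, deriv φ x * v x ^ 2)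
        + 1 / 4 * (∫ x, deriv φ x * v x) ^ 2 := by
  have hc : Continuous (deriv φ) := hφ.continuous_deriv le_rfl
  have h0 : Integrable (deriv φ) := by
    refine hint.mono hc.aestronglyMeasurable (Eventually.of_forall fun x => ?_)
    rw [norm_mul]
    refine le_mul_of_one_le_left (norm_nonneg _) ?_
    rw [Real.norm_eq_abs, abs_of_nonneg (by positivity)]
    linarith [abs_nonneg x]
  have h1 : Integrable fun x => x * deriv φ x := by
    refine hint.mono (continuous_id.mul hc).aestronglyMeasurable (Eventually.of_forall fun x => ?_)
    rw [norm_mul, norm_mul]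
    refine mul_le_mul_of_nonneg_right ?_ (norm_nonneg _)
    rw [Real.norm_eq_abs, Real.norm_eq_abs, abs_of_nonneg (a := 1 + |x|) (by positivity)]
    linarith
  have hmass : ∫ x, deriv φ x = -2 := by
    rw [integral_of_hasDerivAt_of_tendsto (fun x =>
      ((hφ.differentiable (by norm_num)).differentiableAt (x := x)).hasDerivAt) h0 hbot htop]
    norm_num
  refine ⟨h0, ?_⟩
  obtain ⟨κ, hκ, H⟩ := exists_coercive_of_tau_lt_one (q := fun x => 1 / 2 * deriv φ x)
    (h0.const_mul _) ((h1.const_mul (1 / 2)).congr (Eventually.of_forall fun x => by simp only; ring))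
    (by rw [integral_const_mul, hmass]; norm_num) hτ
  refine ⟨κ, hκ, fun v hv v0 v1 => (H v hv v0 v1).trans (le_of_eq ?_)⟩
  simp_rw [mul_assoc]
  rw [integral_const_mul, integral_const_mul]
  ring

/-! ### Translations in `L²` -/

/-- Translation by `a` on `L²(ℝ)`: `(translate a f)(x) = f (x - a)`. -/
def translate {E : Type*} [NormedAddCommGroup E] [NormedSpace ℝ E] (a : ℝ) :
    Lp E 2 (volume : Measure ℝ) →ₗᵢ[ℝ] Lp E 2 (volume : Measure ℝ) :=
  Lp.compMeasurePreservingₗᵢ ℝ (fun x => x - a) (measurePreserving_sub_right volume a)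

theorem translate_ae_eq {E : Type*} [NormedAddCommGroup E] [NormedSpace ℝ E] (a : ℝ)
    {F : Lp E 2 (volume : Measure ℝ)} {f : ℝ → E} (h : F =ᵐ[volume] f) :
    translate a F =ᵐ[volume] fun x => f (x - a) := by
  have h1 : translate a F =ᵐ[volume] F ∘ fun x => x - a :=
    Lp.coeFn_compMeasurePreserving F (measurePreserving_sub_right volume a)
  exact h1.trans
    ((measurePreserving_sub_right volume a).quasiMeasurePreserving.ae_eq_comp h)

theorem continuous_translate {E : Type*} [NormedAddCommGroup E] [NormedSpace ℝ E]
    (F : Lp E 2 (volume : Measure ℝ)) : Continuous fun a : ℝ => translate a F := by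
  let g : C(ℝ, C(ℝ, ℝ)) := (ContinuousMap.mk (fun q : ℝ × ℝ => q.2 - q.1) (by fun_prop)).curry
  exact (continuous_const (y := F)).compMeasurePreservingLp g.continuous
    (fun a => measurePreserving_sub_right volume a) (by norm_num)

theorem translate_zero {E : Type*} [NormedAddCommGroup E] [NormedSpace ℝ E]
    (F : Lp E 2 (volume : Measure ℝ)) : translate 0 F = F := by
  refine Lp.ext ((translate_ae_eq 0 EventuallyEq.rfl).trans ?_)
  simp

theorem enorm_sq_eq_lintegral {F : Lp ℝ 2 (volume : Measure ℝ)} {f : ℝ → ℝ}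
    (h : F =ᵐ[volume] f) : ‖F‖ₑ ^ 2 = ∫⁻ x, ‖f x‖ₑ ^ 2 := by
  rw [Lp.enorm_def, eLpNorm_congr_ae h]
  simpa using! eLpNorm_nnreal_pow_eq_lintegral (μ := volume) (f := f) (p := 2) (by norm_num)

theorem enorm_integral_Ioc_sq_le (k : ℝ → ℝ) (hk : Measurable k) {a b : ℝ} :
    ‖∫ s in Ioc a b, k s‖ₑ ^ 2 ≤ ENNReal.ofReal (b - a) * ∫⁻ s in Ioc a b, ‖k s‖ₑ ^ 2 := by
  have h1 := enorm_integral_le_lintegral_enorm (μ := volume.restrict (Ioc a b)) k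
  have h2 := ENNReal.lintegral_mul_le_Lp_mul_Lq (volume.restrict (Ioc a b))
    Real.HolderConjugate.two_two (f := fun _ => 1) (g := fun s => ‖k s‖ₑ)
    aemeasurable_const hk.enorm.aemeasurable
  simp only [Pi.mul_apply, one_mul, ENNReal.one_rpow, lintegral_one, Measure.restrict_apply_univ,
    Real.volume_Ioc] at h2
  refine (pow_le_pow_left' (h1.trans h2) 2).trans (le_of_eq ?_)
  rw [mul_pow, ← ENNReal.rpow_natCast, ← ENNReal.rpow_natCast, ← ENNReal.rpow_mul,
    ← ENNReal.rpow_mul]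
  norm_num

/-- Minkowski-type bound for difference quotients of an absolutely continuous function. -/
theorem LocallyAC.lintegral_sub_translate_le {f c : ℝ → ℝ} (hf : LocallyAC f) (hc : Measurable c)
    {a b : ℝ} (hab : a ≤ b) {K : ℝ≥0∞}
    (hK : ∀ s ∈ Ioc a b, ∫⁻ x, ‖deriv f (x - s) - c x‖ₑ ^ 2 ≤ K) :
    ∫⁻ x, ‖f (x - a) - f (x - b) - (b - a) * c x‖ₑ ^ 2 ≤ ENNReal.ofReal (b - a) ^ 2 * K := by
  have hm : Measurable (deriv f) := measurable_deriv f
  -- The remainder is an integral over the shift s. Cauchy–Schwarz in s followed by Tonelli then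
  -- moves the L² norm in x inside.
  have e : ∀ x, f (x - a) - f (x - b) - (b - a) * c x
      = ∫ s in Ioc a b, (deriv f (x - s) - c x) := fun x => by
    have h1 := (hf (x - b) (x - a)).integral_deriv_eq_sub
    have hi : IntervalIntegrable (fun s => deriv f (x - s)) volume a b := by
      simpa using ((hf (x - a) (x - b)).intervalIntegrable_deriv).comp_sub_left x
    rw [← intervalIntegral.integral_comp_sub_left (fun s => deriv f s)] at h1
    rw [← h1, ← intervalIntegral.integral_of_le hab,
      intervalIntegral.integral_sub hi intervalIntegrable_const]
    simp
  calc ∫⁻ x, ‖f (x - a) - f (x - b) - (b - a) * c x‖ₑ ^ 2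
      ≤ ∫⁻ x, ENNReal.ofReal (b - a) * ∫⁻ s in Ioc a b, ‖deriv f (x - s) - c x‖ₑ ^ 2 := by
        refine lintegral_mono fun x => ?_
        rw [e x]
        exact enorm_integral_Ioc_sq_le _ (by fun_prop)
    _ = ENNReal.ofReal (b - a) * ∫⁻ x, ∫⁻ s in Ioc a b, ‖deriv f (x - s) - c x‖ₑ ^ 2 := by
        rw [lintegral_const_mul' _ _ ENNReal.ofReal_ne_top]
    _ = ENNReal.ofReal (b - a) * ∫⁻ s in Ioc a b, ∫⁻ x, ‖deriv f (x - s) - c x‖ₑ ^ 2 := by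
        rw [lintegral_lintegral_swap]
        refine Measurable.aemeasurable ?_
        simp only [Function.uncurry_def]
        fun_prop
    _ ≤ ENNReal.ofReal (b - a) * ∫⁻ s in Ioc a b, K := by
        exact mul_le_mul_right (setLIntegral_mono measurable_const hK) _
    _ = _ := by simp; ring

/-- The preceding bound with c = 0 suffices, since all translates of f' have the same L² norm. Thus
a front differs from its translates by an L² function although it is not in L² itself. -/
theorem LocallyAC.memLp_sub_translate {f : ℝ → ℝ} (hf : LocallyAC f) (h1 : MemLp (deriv f) 2)
    (a : ℝ) : MemLp (fun x => f x - f (x - a)) 2 := by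
  have key : ∀ {a b : ℝ}, a ≤ b → MemLp (fun x => f (x - a) - f (x - b)) 2 := by
    intro a b hab
    refine ⟨(hf.continuous.comp (by fun_prop)).sub
      (hf.continuous.comp (by fun_prop)) |>.aestronglyMeasurable, ?_⟩
    have h := hf.lintegral_sub_translate_le (c := fun _ => 0) measurable_const hab
      (K := ‖h1.toLp‖ₑ ^ 2) (fun s _ => by
        have := enorm_sq_eq_lintegral (translate_ae_eq s h1.coeFn_toLp)
        simp only [sub_zero]
        rw [← this, LinearIsometry.enorm_map])
    simp only [mul_zero, sub_zero] at h
    have h2 := eLpNorm_nnreal_pow_eq_lintegral (μ := volume)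
      (f := fun x => f (x - a) - f (x - b)) (p := 2) (by norm_num)
    have h3 : ENNReal.ofReal (b - a) ^ 2 * ‖h1.toLp‖ₑ ^ 2 < ∞ :=
      ENNReal.mul_lt_top (ENNReal.pow_lt_top ENNReal.ofReal_lt_top)
        (ENNReal.pow_lt_top enorm_lt_top)
    by_contra hcon
    rw [not_lt, top_le_iff] at hcon
    have h4 := h.trans_lt h3
    simp at h2
    rw [← h2, hcon] at h4
    simp at h4
  rcases le_total 0 a with h | h
  · simpa using key h
  · refine ((key h).neg).ae_eq (Eventually.of_forall fun x => ?_)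
    simp

/-- `f - f(· - a)` as an element of `L²`, for absolutely continuous `f` with `f' ∈ L²`. -/
def LocallyAC.increment {f : ℝ → ℝ} (hf : LocallyAC f) (h1 : MemLp (deriv f) 2) (a : ℝ) :
    Lp ℝ 2 (volume : Measure ℝ) :=
  (hf.memLp_sub_translate h1 a).toLp

theorem LocallyAC.increment_ae_eq {f : ℝ → ℝ} (hf : LocallyAC f) (h1 : MemLp (deriv f) 2)
    (a : ℝ) : hf.increment h1 a =ᵐ[volume] fun x => f x - f (x - a) :=
  MemLp.coeFn_toLp _

/-- The remainder has norm at most |b - a| times the largest distance in L² between f'(· - s) and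
f'(· - a) for s between a and b, which is small by continuity of translations. -/
theorem LocallyAC.hasDerivAt_increment {f : ℝ → ℝ} (hf : LocallyAC f) (h1 : MemLp (deriv f) 2)
    (a : ℝ) : HasDerivAt (hf.increment h1) (translate a h1.toLp) a := by
  rw [hasDerivAt_iff_isLittleO, Asymptotics.isLittleO_iff]
  intro ε hε
  obtain ⟨δ, hδ, H⟩ := Metric.continuousAt_iff.1
    ((continuous_translate h1.toLp).continuousAt (x := a)) ε hε
  have hm : Measurable (deriv f) := measurable_deriv f
  have hK : ∀ s, dist s a < δ →
      ∫⁻ x, ‖deriv f (x - s) - deriv f (x - a)‖ₑ ^ 2 ≤ ENNReal.ofReal ε ^ 2 := fun s hs => by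
    have e : (translate s h1.toLp - translate a h1.toLp : Lp ℝ 2 (volume : Measure ℝ))
        =ᵐ[volume] fun x => deriv f (x - s) - deriv f (x - a) :=
      (Lp.coeFn_sub _ _).trans
        ((translate_ae_eq s h1.coeFn_toLp).sub (translate_ae_eq a h1.coeFn_toLp))
    rw [← enorm_sq_eq_lintegral e, ← ofReal_norm, ← dist_eq_norm]
    gcongr
    exact (H hs).le
  filter_upwards [Metric.ball_mem_nhds a hδ] with b hb
  rw [Metric.mem_ball, Real.dist_eq] at hb
  have e : (hf.increment h1 b - hf.increment h1 a - (b - a) • translate a h1.toLp :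
      Lp ℝ 2 (volume : Measure ℝ))
      =ᵐ[volume] fun x => f (x - a) - f (x - b) - (b - a) * deriv f (x - a) := by
    filter_upwards [Lp.coeFn_sub (hf.increment h1 b - hf.increment h1 a)
      ((b - a) • translate a h1.toLp), Lp.coeFn_sub (hf.increment h1 b) (hf.increment h1 a),
      Lp.coeFn_smul (b - a) (translate a h1.toLp), translate_ae_eq a h1.coeFn_toLp,
      hf.increment_ae_eq h1 a, hf.increment_ae_eq h1 b] with x e1 e2 e3 e4 e5 e6
    rw [e1, Pi.sub_apply, e2, Pi.sub_apply, e3, Pi.smul_apply, e4, e5, e6, smul_eq_mul]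
    ring
  have hle : ‖(hf.increment h1 b - hf.increment h1 a - (b - a) • translate a h1.toLp :
      Lp ℝ 2 (volume : Measure ℝ))‖ₑ ^ 2 ≤ ENNReal.ofReal (ε * ‖b - a‖) ^ 2 := by
    rw [enorm_sq_eq_lintegral e, ENNReal.ofReal_mul hε.le, mul_pow, mul_comm, Real.norm_eq_abs]
    have hc : Measurable fun x => deriv f (x - a) := by fun_prop
    rcases le_total a b with h | h
    · rw [abs_of_nonneg (sub_nonneg.2 h)]
      refine hf.lintegral_sub_translate_le hc h fun s hs => hK s ?_
      rw [Real.dist_eq]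
      rw [abs_of_nonneg (sub_nonneg.2 h)] at hb
      rw [abs_of_nonneg (sub_nonneg.2 hs.1.le)]
      linarith [hs.2]
    · rw [abs_of_nonpos (sub_nonpos.2 h), neg_sub]
      rw [abs_of_nonpos (sub_nonpos.2 h)] at hb
      have := hf.lintegral_sub_translate_le hc h (K := ENNReal.ofReal ε ^ 2) fun s hs => hK s (by
        rw [Real.dist_eq, abs_of_nonpos (sub_nonpos.2 hs.2)]
        linarith [hs.1])
      refine le_trans (le_of_eq ?_) this
      refine lintegral_congr fun x => ?_
      rw [← enorm_neg]
      congr 2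
      ring
  have := (ENNReal.pow_le_pow_left_iff (n := 2) (by norm_num)).1 hle
  rw [← ofReal_norm] at this
  exact (ENNReal.ofReal_le_ofReal_iff (by positivity)).1 this

theorem LocallyAC.increment_sub_le {f : ℝ → ℝ} (hf : LocallyAC f) (h1 : MemLp (deriv f) 2)
    (a b : ℝ) : ‖hf.increment h1 a - hf.increment h1 b‖ ≤ ‖h1.toLp‖ * ‖a - b‖ :=
  convex_univ.norm_image_sub_le_of_norm_hasDerivWithin_le
    (fun x _ => (hf.hasDerivAt_increment h1 x).hasDerivWithinAt)
    (fun _ _ => (LinearIsometry.norm_map _ _).le) (mem_univ b) (mem_univ a)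

theorem LocallyAC.increment_zero {f : ℝ → ℝ} (hf : LocallyAC f) (h1 : MemLp (deriv f) 2) :
    hf.increment h1 0 = 0 := by
  refine Lp.ext ((hf.increment_ae_eq h1 0).trans ?_)
  filter_upwards [Lp.coeFn_zero ℝ 2 (volume : Measure ℝ)] with x hx
  rw [hx]
  simp

/-! ### Fourier transform of translates and derivatives in `L²` -/

theorem memLp_fourierChar (a : ℝ) :
    MemLp (fun ξ : ℝ => (Real.fourierChar (-(a * ξ)) : ℂ)) ∞ volume :=
  memLp_top_of_bound (by fun_prop) 1 (Eventually.of_forall fun ξ => (Circle.norm_coe _).le)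

/-- Both sides depend continuously on F in L², so Schwartz functions suffice, where the transform is
an explicit integral. -/
theorem fourier_translate (a : ℝ) (F : Lp ℂ 2 (volume : Measure ℝ)) :
    (𝓕 (translate a F) : Lp ℂ 2 (volume : Measure ℝ)) =ᵐ[volume]
      fun ξ => (Real.fourierChar (-(a * ξ)) : ℂ) * (𝓕 F : Lp ℂ 2 (volume : Measure ℝ)) ξ := by
  have key : (𝓕 (translate a F) : Lp ℂ 2 (volume : Measure ℝ)) =
      ((memLp_fourierChar a).toLp • (𝓕 F : Lp ℂ 2 (volume : Measure ℝ)) :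
        Lp ℂ 2 (volume : Measure ℝ)) := by
    refine DenseRange.induction_on (p := fun F : Lp ℂ 2 (volume : Measure ℝ) =>
      (𝓕 (translate a F) : Lp ℂ 2 (volume : Measure ℝ)) =
      ((memLp_fourierChar a).toLp • (𝓕 F : Lp ℂ 2 (volume : Measure ℝ)) :
        Lp ℂ 2 (volume : Measure ℝ)))
      (SchwartzMap.denseRange_toLpCLM (E := ℝ) (F := ℂ) (p := 2) (μ := volume)
        ENNReal.ofNat_ne_top) F ?_ ?_
    · refine isClosed_eq ((Lp.fourierTransformₗᵢ ℝ ℂ).continuous.comp (translate a).continuous) ?_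
      exact (((ContinuousLinearMap.lsmul ℂ ℂ (E := ℂ)).holderL volume ∞ 2 2
        (memLp_fourierChar a).toLp).continuous.comp (Lp.fourierTransformₗᵢ ℝ ℂ).continuous)
    · intro f
      have e : translate a (f.toLp 2 : Lp ℂ 2 (volume : Measure ℝ))
          = (f.compSubConstCLM ℂ a).toLp 2 := by
        refine Lp.ext ((translate_ae_eq a (f.coeFn_toLp 2 volume)).trans ?_)
        filter_upwards [(f.compSubConstCLM ℂ a).coeFn_toLp 2 volume] with x hx
        rw [hx, SchwartzMap.compSubConstCLM_apply]
      change (𝓕 (translate a (f.toLp 2)) : Lp ℂ 2 (volume : Measure ℝ)) =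
        ((memLp_fourierChar a).toLp • (𝓕 (f.toLp 2) : Lp ℂ 2 (volume : Measure ℝ)) :
          Lp ℂ 2 (volume : Measure ℝ))
      rw [e, SchwartzMap.toLp_fourier_eq, SchwartzMap.toLp_fourier_eq]
      refine Lp.ext ?_
      filter_upwards [(𝓕 (f.compSubConstCLM ℂ a)).coeFn_toLp 2 volume,
        (𝓕 f).coeFn_toLp 2 volume, (memLp_fourierChar a).coeFn_toLp,
        Lp.coeFn_lpSMul (r := 2) (memLp_fourierChar a).toLp ((𝓕 f).toLp 2)] with ξ h1 h2 h3 h4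
      rw [h1, h4, Pi.smul_apply', h3, h2, SchwartzMap.fourier_coe, SchwartzMap.fourier_coe]
      have h5 := congrFun (VectorFourier.fourierIntegral_comp_add_right Real.fourierChar volume
        (innerₗ ℝ) (f : ℝ → ℂ) (-a)) ξ
      have h6 : ((f : ℝ → ℂ) ∘ fun v => v + -a) = (f.compSubConstCLM ℂ a : ℝ → ℂ) := by
        ext x; simp [sub_eq_add_neg]
      rw [h6] at h5
      refine h5.trans ?_
      simp [Circle.smul_def, mul_comm]
      rfl
  rw [key]
  filter_upwards [(memLp_fourierChar a).coeFn_toLp, Lp.coeFn_lpSMul (r := 2)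
    (memLp_fourierChar a).toLp (𝓕 F : Lp ℂ 2 (volume : Measure ℝ))] with ξ h3 h4
  rw [h4, Pi.smul_apply', h3, smul_eq_mul]

theorem hasDerivAt_fourierChar_zero (ξ : ℝ) :
    HasDerivAt (fun a : ℝ => 1 - (Real.fourierChar (-(a * ξ)) : ℂ))
      (Complex.I * ((2 * Real.pi * ξ : ℝ) : ℂ)) 0 := by
  have h : HasDerivAt (fun a : ℝ => Complex.exp (((2 * Real.pi * -(a * ξ) : ℝ) : ℂ) * Complex.I))
      (-(Complex.I * ((2 * Real.pi * ξ : ℝ) : ℂ))) 0 := by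
    have h1 : HasDerivAt (fun a : ℝ => 2 * Real.pi * -(a * ξ)) (2 * Real.pi * -ξ) 0 := by
      simpa using (((hasDerivAt_id (0 : ℝ)).mul_const ξ).neg).const_mul (2 * Real.pi)
    convert! ((h1.ofReal_comp).mul_const Complex.I).cexp using 1
    simp
    ring
  simp only [Real.fourierChar_apply]
  simpa using h.const_sub 1

/-- The increments v - v(· - a) have L² derivative v' at a = 0, and the L² Fourier transform
preserves this. On the Fourier side the difference quotients are (1 - e^{-2πiaξ})/a times the
transform of v, which converge pointwise. -/
theorem fourier_deriv {v : ℝ → ℝ} (hv : LocallyAC v) (v1 : MemLp (deriv v) 2)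
    {V V1 : Lp ℂ 2 (volume : Measure ℝ)} (hV : V =ᵐ[volume] fun x => ((v x : ℝ) : ℂ))
    (hV1 : V1 =ᵐ[volume] fun x => ((deriv v x : ℝ) : ℂ)) :
    ∀ᵐ ξ : ℝ, (𝓕 V1 : Lp ℂ 2 (volume : Measure ℝ)) ξ =
      Complex.I * ((2 * Real.pi * ξ : ℝ) : ℂ) * (𝓕 V : Lp ℂ 2 (volume : Measure ℝ)) ξ := by
  let C : Lp ℝ 2 (volume : Measure ℝ) →L[ℝ] Lp ℂ 2 (volume : Measure ℝ) :=
    Complex.ofRealCLM.compLpL 2 volume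
  let T : Lp ℂ 2 (volume : Measure ℝ) →L[ℝ] Lp ℂ 2 (volume : Measure ℝ) :=
    ((Lp.fourierTransformₗᵢ ℝ ℂ).toContinuousLinearEquiv :
      Lp ℂ 2 (volume : Measure ℝ) →L[ℂ] Lp ℂ 2 (volume : Measure ℝ)).restrictScalars ℝ
  have hC : ∀ {F : Lp ℝ 2 (volume : Measure ℝ)} {f : ℝ → ℝ}, F =ᵐ[volume] f →
      C F =ᵐ[volume] fun x => ((f x : ℝ) : ℂ) := fun {F f} h => by
    filter_upwards [Complex.ofRealCLM.coeFn_compLpL (p := 2) (μ := volume) F, h] with x h1 h2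
    rw [h1, h2]
    rfl
  have hQ : ∀ a, C (hv.increment v1 a) = V - translate a V := fun a => by
    refine Lp.ext ((hC (hv.increment_ae_eq v1 a)).trans ?_)
    filter_upwards [Lp.coeFn_sub V (translate a V), hV, translate_ae_eq a hV] with x h1 h2 h3
    rw [h1, Pi.sub_apply, h2, h3]
    push_cast
    rfl
  have hV1' : C (translate 0 v1.toLp) = V1 := by
    rw [translate_zero]
    exact Lp.ext ((hC v1.coeFn_toLp).trans hV1.symm)
  have hd : HasDerivAt (fun a => T (C (hv.increment v1 a))) (T V1) 0 := by
    rw [← hV1']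
    exact T.hasFDerivAt.comp_hasDerivAt 0
      (C.hasFDerivAt.comp_hasDerivAt 0 (hv.hasDerivAt_increment v1 0))
  let t : ℕ → ℝ := fun n => 1 / ((n : ℝ) + 1)
  have ht : Tendsto t atTop (𝓝[≠] 0) := tendsto_nhdsWithin_iff.2
    ⟨tendsto_one_div_add_atTop_nhds_zero_nat, Eventually.of_forall fun n => by
      simp only [t, mem_compl_iff, mem_singleton_iff]
      positivity⟩
  have hlim := (hd.tendsto_slope_zero).comp ht
  -- L² convergence yields almost everywhere convergence along a subsequence, enough to identify the
  -- two limits.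
  obtain ⟨ns, hns, hae⟩ := (tendstoInMeasure_of_tendsto_Lp hlim).exists_seq_tendsto_ae
  have hval : ∀ᵐ ξ : ℝ, ∀ n, ((t n)⁻¹ • (T (C (hv.increment v1 (0 + t n)))
      - T (C (hv.increment v1 0))) : Lp ℂ 2 (volume : Measure ℝ)) ξ =
      (t n)⁻¹ • (1 - (Real.fourierChar (-(t n * ξ)) : ℂ)) *
        (𝓕 V : Lp ℂ 2 (volume : Measure ℝ)) ξ := by
    refine ae_all_iff.2 fun n => ?_
    have e : (T (C (hv.increment v1 (0 + t n))) - T (C (hv.increment v1 0)) :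
        Lp ℂ 2 (volume : Measure ℝ)) = 𝓕 V - 𝓕 (translate (t n) V) := by
      rw [hv.increment_zero, map_zero, map_zero, sub_zero, zero_add, hQ, map_sub]
      rfl
    rw [e]
    filter_upwards [Lp.coeFn_smul (t n)⁻¹ (𝓕 V - 𝓕 (translate (t n) V) :
      Lp ℂ 2 (volume : Measure ℝ)), Lp.coeFn_sub (𝓕 V : Lp ℂ 2 (volume : Measure ℝ))
      (𝓕 (translate (t n) V)), fourier_translate (t n) V] with ξ h1 h2 h3
    rw [h1, Pi.smul_apply, h2, Pi.sub_apply, h3, smul_mul_assoc]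
    ring_nf
  filter_upwards [hae, hval] with ξ h1 h2
  have h3 := (((hasDerivAt_fourierChar_zero ξ).tendsto_slope_zero.comp ht).comp
    hns.tendsto_atTop).mul_const ((𝓕 V : Lp ℂ 2 (volume : Measure ℝ)) ξ)
  refine tendsto_nhds_unique h1 (h3.congr fun n => ?_)
  simp only [Function.comp_apply]
  rw [h2 (ns n)]
  simp

/-! ### Fourier multipliers -/

/-- Translation multiplies both transforms by the same phase factor, which commutes with the symbol.
-/
theorem IsMultiplierImage.comp_sub_const {ℓ : ℝ → ℂ} {f g : ℝ → ℝ} (h : IsMultiplierImage ℓ f g)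
    (a : ℝ) : IsMultiplierImage ℓ (fun x => f (x - a)) (fun x => g (x - a)) := by
  obtain ⟨hf, F, G, hF, hG, H⟩ := h
  refine ⟨hf.comp (contDiff_id.sub contDiff_const), translate a F, translate a G, ?_,
    translate_ae_eq a hG, ?_⟩
  · refine (translate_ae_eq a hF).trans (Eventually.of_forall fun x => ?_)
    simp [deriv_comp_sub_const]
  · filter_upwards [H, fourier_translate a F, fourier_translate a G] with ξ h1 h2 h3
    rw [h2, h3, mul_left_comm, h1, mul_left_comm]

theorem IsMultiplierImage.sub {ℓ : ℝ → ℂ} {f₁ g₁ f₂ g₂ : ℝ → ℝ} (h₁ : IsMultiplierImage ℓ f₁ g₁)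
    (h₂ : IsMultiplierImage ℓ f₂ g₂) :
    IsMultiplierImage ℓ (fun x => f₁ x - f₂ x) (fun x => g₁ x - g₂ x) := by
  obtain ⟨hf₁, F₁, G₁, hF₁, hG₁, H₁⟩ := h₁
  obtain ⟨hf₂, F₂, G₂, hF₂, hG₂, H₂⟩ := h₂
  refine ⟨hf₁.sub hf₂, F₁ - F₂, G₁ - G₂, ?_, ?_, ?_⟩
  · filter_upwards [Lp.coeFn_sub F₁ F₂, hF₁, hF₂] with x h1 h2 h3
    rw [h1, Pi.sub_apply, h2, h3, deriv_fun_sub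
      (hf₁.differentiable (by norm_num)).differentiableAt
      (hf₂.differentiable (by norm_num)).differentiableAt]
    push_cast
    rfl
  · filter_upwards [Lp.coeFn_sub G₁ G₂, hG₁, hG₂] with x h1 h2 h3
    rw [h1, Pi.sub_apply, h2, h3]
    push_cast
    rfl
  · have e : ∀ A B : Lp ℂ 2 (volume : Measure ℝ), (𝓕 (A - B) : Lp ℂ 2 (volume : Measure ℝ))
        = 𝓕 A - 𝓕 B := fun A B => map_sub (Lp.fourierTransformₗᵢ ℝ ℂ) A B
    rw [e, e]
    filter_upwards [Lp.coeFn_sub (𝓕 F₁ : Lp ℂ 2 (volume : Measure ℝ)) (𝓕 F₂),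
      Lp.coeFn_sub (𝓕 G₁ : Lp ℂ 2 (volume : Measure ℝ)) (𝓕 G₂), H₁, H₂] with ξ h1 h2 h3 h4
    rw [h1, h2, Pi.sub_apply, Pi.sub_apply, mul_sub, mul_sub, h3, h4]

theorem memLp_ofReal {f : ℝ → ℝ} (hf : MemLp f 2) : MemLp (fun x => ((f x : ℝ) : ℂ)) 2 volume :=
  hf.ofReal

theorem IsMultiplierImage.memLp {ℓ : ℝ → ℂ} {f g : ℝ → ℝ} (h : IsMultiplierImage ℓ f g) :
    MemLp (deriv f) 2 ∧ MemLp g 2 := by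
  obtain ⟨hf, F, G, hF, hG, H⟩ := h
  exact ⟨((Lp.memLp F).ae_eq hF).re, ((Lp.memLp G).ae_eq hG).re⟩

theorem integral_mul_eq_re_inner {f g : ℝ → ℝ} {F G : Lp ℂ 2 (volume : Measure ℝ)}
    (hF : F =ᵐ[volume] fun x => ((f x : ℝ) : ℂ)) (hG : G =ᵐ[volume] fun x => ((g x : ℝ) : ℂ)) :
    ∫ x, f x * g x = ∫ ξ, ((starRingEnd ℂ) ((𝓕 F : Lp ℂ 2 (volume : Measure ℝ)) ξ) *
      (𝓕 G : Lp ℂ 2 (volume : Measure ℝ)) ξ).re := by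
  have h1 : inner ℂ F G = ((∫ x, f x * g x : ℝ) : ℂ) := by
    rw [L2.inner_def, ← integral_complex_ofReal]
    refine integral_congr_ae ?_
    filter_upwards [hF, hG] with x h1 h2
    rw [h1, h2]
    simp [mul_comm]
  have h2 := Lp.inner_fourier_eq F G
  have h3 := L2.integrable_inner (𝕜 := ℂ) (𝓕 F : Lp ℂ 2 (volume : Measure ℝ)) (𝓕 G)
  rw [L2.inner_def, h1] at h2
  have h4 := congrArg Complex.re h2
  rw [Complex.ofReal_re] at h4
  rw [← h4]
  refine (integral_re h3).symm.trans (integral_congr_ae (Eventually.of_forall fun ξ => ?_))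
  simp [mul_comm]

/-- A multiplier whose symbol has nonpositive real part is dissipative in `L²`. -/
theorem IsMultiplierImage.integral_mul_nonpos {ℓ : ℝ → ℂ} (hℓ : ∀ k, (ℓ k).re ≤ 0)
    {v h : ℝ → ℝ} (H : IsMultiplierImage ℓ v h) (v0 : MemLp v 2) : ∫ x, h x * v x ≤ 0 := by
  have m := H.memLp
  obtain ⟨hv, F, G, hF, hG, H⟩ := H
  rw [integral_mul_eq_re_inner hG (memLp_ofReal v0).coeFn_toLp]
  refine integral_nonpos_of_ae ?_
  have hne : ∀ᵐ ξ : ℝ, ξ ≠ 0 := by simp [ae_iff]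
  filter_upwards [H, hne, fourier_deriv (LocallyAC.of_contDiff hv) m.1
    (memLp_ofReal v0).coeFn_toLp hF] with ξ h1 h2 h3
  -- Since v itself is in L², the transform of v' is ik times that of v. The factor ik cancels off
  -- the null set ξ = 0, leaving the usual multiplier relation.
  rw [h3, mul_left_comm] at h1
  have hk : Complex.I * ((2 * Real.pi * ξ : ℝ) : ℂ) ≠ 0 := by
    simp [h2, Real.pi_ne_zero]
  rw [mul_left_cancel₀ hk h1, map_mul, mul_assoc, ← Complex.normSq_eq_conj_mul_self]
  simpa using mul_nonpos_of_nonpos_of_nonneg (hℓ _) (Complex.normSq_nonneg _)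

/-- A multiplier whose symbol has nonpositive real part is dissipative in `Ḣ¹`. -/
theorem IsMultiplierImage.integral_mul_deriv_deriv_nonneg {ℓ : ℝ → ℂ} (hℓ : ∀ k, (ℓ k).re ≤ 0)
    {v h : ℝ → ℝ} (H : IsMultiplierImage ℓ v h) (v0 : MemLp v 2) (hv' : LocallyAC (deriv v))
    (v2 : MemLp (deriv (deriv v)) 2) : 0 ≤ ∫ x, h x * deriv (deriv v) x := by
  have m := H.memLp
  obtain ⟨hv, F, G, hF, hG, H⟩ := H
  rw [integral_mul_eq_re_inner hG (memLp_ofReal v2).coeFn_toLp]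
  refine integral_nonneg_of_ae ?_
  have hne : ∀ᵐ ξ : ℝ, ξ ≠ 0 := by simp [ae_iff]
  filter_upwards [H, hne, fourier_deriv (LocallyAC.of_contDiff hv) m.1
    (memLp_ofReal v0).coeFn_toLp hF, fourier_deriv hv' v2 hF
    (memLp_ofReal v2).coeFn_toLp] with ξ h1 h2 h3 h4
  rw [h3, mul_left_comm] at h1
  have hk : Complex.I * ((2 * Real.pi * ξ : ℝ) : ℂ) ≠ 0 := by
    simp [h2, Real.pi_ne_zero]
  rw [h4, h3, mul_left_cancel₀ hk h1, map_mul]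
  set z := (𝓕 ((memLp_ofReal v0).toLp) : Lp ℂ 2 (volume : Measure ℝ)) ξ
  -- The factor (ik)² = -k² reverses the sign relative to the L² estimate: the integrand is -k²
  -- |v̂|² Re ℓ.
  have e : (starRingEnd ℂ) (ℓ (2 * Real.pi * ξ)) * (starRingEnd ℂ) z *
      (Complex.I * ((2 * Real.pi * ξ : ℝ) : ℂ) * (Complex.I * ((2 * Real.pi * ξ : ℝ) : ℂ) * z))
      = (starRingEnd ℂ) (ℓ (2 * Real.pi * ξ)) *
        ((-(2 * Real.pi * ξ) ^ 2 * Complex.normSq z : ℝ) : ℂ) := by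
    push_cast
    rw [Complex.normSq_eq_conj_mul_self]
    linear_combination ((starRingEnd ℂ) (ℓ (2 * Real.pi * ξ)) * (starRingEnd ℂ) z * z *
      (2 * Real.pi * ξ) ^ 2) * Complex.I_sq
  rw [e, Complex.re_mul_ofReal, Complex.conj_re]
  refine mul_nonneg_of_nonpos_of_nonpos (hℓ _) ?_
  have := mul_nonneg (sq_nonneg (2 * Real.pi * ξ)) (Complex.normSq_nonneg z)
  linarith

/-! ### Global solutions of scalar ordinary differential equations -/

open scoped NNReal in
/-- A scalar field on `[0, ∞) × ℝ` that is bounded on bounded time intervals and locally Lipschitz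
in space has a global integral curve. -/
theorem exists_global_integralCurve {F : ℝ → ℝ → ℝ}
    (hcont : ∀ x, ContinuousOn (fun t => F t x) (Ici 0))
    (hbd : ∀ T : ℝ, ∃ L : ℝ≥0, ∀ t ∈ Icc 0 T, ∀ x, ‖F t x‖ ≤ L)
    (hlip : ∀ T R : ℝ, ∃ K : ℝ≥0, ∀ t ∈ Icc 0 T, LipschitzOnWith K (F t) (Metric.closedBall 0 R)) :
    ∃ α : ℝ → ℝ, ∀ t : ℝ, 0 < t → HasDerivAt α (F t (α t)) t := by
  have hex : ∀ n : ℕ, ∃ α : ℝ → ℝ, α 0 = 0 ∧ ∀ t ∈ Icc (0 : ℝ) (n + 1),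
      HasDerivWithinAt α (F t (α t)) (Icc 0 ((n : ℝ) + 1)) t := by
    intro n
    obtain ⟨L, hL⟩ := hbd (n + 1)
    obtain ⟨K, hK⟩ := hlip (n + 1) (L * (n + 1))
    -- A speed of at most L cannot leave the ball of radius L (n + 1) within time n + 1, so the
    -- Picard–Lindelöf solution covers the whole interval.
    have hpl : IsPicardLindelof F (tmin := 0) (tmax := (n : ℝ) + 1)
        ⟨0, le_rfl, by positivity⟩ (0 : ℝ) (L * (n + 1)) 0 L K := by
      refine ⟨fun t ht => ?_, fun x _ => (hcont x).mono fun t ht => ht.1,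
        fun t ht x _ => hL t ht x, ?_⟩
      · simpa using hK t ht
      · have : (0 : ℝ) ≤ n + 1 := by positivity
        simp [this]
    exact hpl.exists_eq_forall_mem_Icc_hasDerivWithinAt₀
  choose α h0 hα using hex
  have hright : ∀ n : ℕ, ∀ t ∈ Ico (0 : ℝ) (n + 1), HasDerivWithinAt (α n) (F t (α n t)) (Ici t) t :=
    fun n t ht => (hα n t (Ico_subset_Icc_self ht)).mono_of_mem_nhdsWithin
      (Icc_mem_nhdsGE_of_mem ht)
  have huniq : ∀ m n : ℕ, m ≤ n → EqOn (α m) (α n) (Icc 0 ((m : ℝ) + 1)) := by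
    intro m n hmn
    have hmn' : (m : ℝ) ≤ n := by exact_mod_cast hmn
    have hsub : Icc (0 : ℝ) (m + 1) ⊆ Icc 0 (n + 1) := Icc_subset_Icc_right (by linarith)
    have cm : ContinuousOn (α m) (Icc 0 ((m : ℝ) + 1)) := fun t ht =>
      (hα m t ht).continuousWithinAt
    have cn : ContinuousOn (α n) (Icc 0 ((m : ℝ) + 1)) := fun t ht =>
      (hα n t (hsub ht)).continuousWithinAt.mono hsub
    obtain ⟨R₁, hR₁⟩ := isCompact_Icc.exists_bound_of_continuousOn cm
    obtain ⟨R₂, hR₂⟩ := isCompact_Icc.exists_bound_of_continuousOn cn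
    obtain ⟨K, hK⟩ := hlip (m + 1) (max R₁ R₂)
    refine ODE_solution_unique_of_mem_Icc_right (s := fun _ => Metric.closedBall 0 (max R₁ R₂))
      (K := K) (v := F) (fun t ht => hK t (Ico_subset_Icc_self ht)) cm (hright m) (fun t ht => ?_)
      cn (fun t ht => hright n t ⟨ht.1, ht.2.trans_le (by linarith)⟩) (fun t ht => ?_)
      ((h0 m).trans (h0 n).symm)
    · simpa using Or.inl (hR₁ t (Ico_subset_Icc_self ht))
    · simpa using Or.inr (hR₂ t (Ico_subset_Icc_self ht))
  have huniq' : ∀ m n : ℕ, ∀ t : ℝ, 0 ≤ t → t ≤ m + 1 → t ≤ n + 1 → α m t = α n t := by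
    intro m n t ht hm hn
    rcases le_total m n with h | h
    · exact huniq m n h ⟨ht, hm⟩
    · exact (huniq n m h ⟨ht, hn⟩).symm
  -- The curve of index ⌈t⌉ lives on [0, ⌈t⌉ + 1]. The extra unit puts t in the interior, so the
  -- derivative is two-sided.
  refine ⟨fun t => α ⌈t⌉₊ t, fun t ht => ?_⟩
  have htN := Nat.le_ceil t
  have hmem : Icc 0 ((⌈t⌉₊ : ℝ) + 1) ∈ 𝓝 t := Icc_mem_nhds ht (by linarith)
  refine ((hα ⌈t⌉₊ t ⟨ht.le, by linarith⟩).hasDerivAt hmem).congr_of_eventuallyEq ?_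
  filter_upwards [hmem] with s hs
  exact huniq' _ _ s hs.1 ((Nat.le_ceil s).trans (le_add_of_nonneg_right zero_le_one)) hs.2

/-! ### A Barbalat-type lemma -/

theorem sub_le_mul_sub_of_hasDerivAt {f f' : ℝ → ℝ} {t₀ C : ℝ}
    (hf : ∀ t, t₀ < t → HasDerivAt f (f' t) t) {s t : ℝ} (hs : t₀ < s) (hst : s ≤ t)
    (hC : ∀ r ∈ Icc s t, f' r ≤ C) : f t - f s ≤ C * (t - s) := by
  refine (convex_Icc s t).image_sub_le_mul_sub_of_deriv_le
    (fun r hr => (hf r (hs.trans_le hr.1)).continuousAt.continuousWithinAt)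
    (fun r hr => ?_) (fun r hr => ?_) s ⟨le_rfl, hst⟩ t ⟨hst, le_rfl⟩ hst
  all_goals rw [interior_Icc] at hr
  · exact (hf r (hs.trans hr.1)).differentiableAt.differentiableWithinAt
  · rw [(hf r (hs.trans hr.1)).deriv]
    exact hC r (Ioo_subset_Icc_self hr)

/-- If Z(t) ≥ ε, the upper bound on Z' forces Z ≥ ε/2 on the interval of length η = ε/(2C) before t.
There e loses at least κ (ε/2) η, which is impossible at late times because e is decreasing and
bounded below. Looking backward is why a one-sided bound on Z' suffices. -/
theorem tendsto_zero_of_lyapunov {e e' Z Z' : ℝ → ℝ} {t₀ κ C : ℝ} (hκ : 0 < κ) (hC : 0 < C)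
    (he : ∀ t, t₀ < t → HasDerivAt e (e' t) t) (he' : ∀ t, t₀ < t → e' t ≤ -(κ * Z t))
    (he0 : ∀ t, t₀ < t → 0 ≤ e t) (hZ : ∀ t, t₀ < t → HasDerivAt Z (Z' t) t)
    (hZ' : ∀ t, t₀ < t → Z' t ≤ C) (hZ0 : ∀ t, t₀ < t → 0 ≤ Z t) :
    Tendsto Z atTop (𝓝 0) := by
  have hanti : ∀ s t, t₀ < s → s ≤ t → e t ≤ e s := fun s t hs hst => by
    have := sub_le_mul_sub_of_hasDerivAt he hs hst (C := 0) fun r hr => by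
      have h1 := he' r (hs.trans_le hr.1)
      have h2 := mul_nonneg hκ.le (hZ0 r (hs.trans_le hr.1))
      linarith
    linarith
  have hlim : ∃ l, Tendsto e atTop (𝓝 l) := by
    let g : ℝ → ℝ := fun t => e (max t (t₀ + 1))
    have hg : Antitone g := fun s t hst =>
      hanti _ _ (lt_of_lt_of_le (by linarith) (le_max_right _ _)) (max_le_max_right _ hst)
    have hb : BddBelow (range g) := ⟨0, by
      rintro _ ⟨t, rfl⟩
      exact he0 _ (lt_of_lt_of_le (by linarith) (le_max_right _ _))⟩
    refine ⟨_, (tendsto_atTop_ciInf hg hb).congr' ?_⟩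
    filter_upwards [eventually_ge_atTop (t₀ + 1)] with t ht
    simp [g, ht]
  obtain ⟨l, hl⟩ := hlim
  rw [tendsto_order]
  refine ⟨fun a ha => ?_, fun ε hε => ?_⟩
  · filter_upwards [eventually_gt_atTop t₀] with t ht
    exact ha.trans_le (hZ0 t ht)
  · set η := ε / (2 * C)
    have hη : 0 < η := by positivity
    have hdiff : Tendsto (fun t => e (t - η) - e t) atTop (𝓝 (l - l)) :=
      (hl.comp (tendsto_atTop_add_const_right _ (-η) tendsto_id)).sub hl
    rw [sub_self] at hdiff
    filter_upwards [eventually_gt_atTop (t₀ + η),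
      hdiff.eventually_lt_const (show 0 < κ * (ε / 2) * η by positivity)] with t ht hlt
    by_contra! hcon
    have hts : t₀ < t - η := by linarith
    have hlow : ∀ r ∈ Icc (t - η) t, ε / 2 ≤ Z r := fun r hr => by
      have h1 := sub_le_mul_sub_of_hasDerivAt hZ (hts.trans_le hr.1) hr.2 (C := C)
        fun q hq => hZ' q ((hts.trans_le hr.1).trans_le hq.1)
      have h2 : C * (t - r) ≤ C * η := mul_le_mul_of_nonneg_left (by linarith [hr.1]) hC.le
      have h3 : C * η = ε / 2 := by simp only [η]; field_simp
      linarith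
    have := sub_le_mul_sub_of_hasDerivAt he hts (by linarith) (C := -(κ * (ε / 2)))
      fun r hr => (he' r (hts.trans_le hr.1)).trans
        (neg_le_neg (mul_le_mul_of_nonneg_left (hlow r hr) hκ.le))
    rw [sub_sub_cancel] at this
    linarith

/-- The substitution Z = 1 - 1/(1 + y) absorbs the quadratic growth: Z' = y'/(1 + y)² ≤ C, while Z =
y/(1 + y) ≤ y keeps the dissipation inequality. -/
theorem tendsto_zero_of_lyapunov_of_le_sq {e e' y y' : ℝ → ℝ} {t₀ κ C : ℝ} (hκ : 0 < κ)
    (hC : 0 < C) (he : ∀ t, t₀ < t → HasDerivAt e (e' t) t)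
    (he' : ∀ t, t₀ < t → e' t ≤ -(κ * y t)) (he0 : ∀ t, t₀ < t → 0 ≤ e t)
    (hy : ∀ t, t₀ < t → HasDerivAt y (y' t) t) (hy' : ∀ t, t₀ < t → y' t ≤ C * (1 + y t) ^ 2)
    (hy0 : ∀ t, t₀ < t → 0 ≤ y t) : Tendsto y atTop (𝓝 0) := by
  have hZ : Tendsto (fun t => 1 - (1 + y t)⁻¹) atTop (𝓝 0) := by
    refine tendsto_zero_of_lyapunov (Z' := fun t => y' t / (1 + y t) ^ 2) hκ hC he
      (fun t ht => (he' t ht).trans (neg_le_neg (mul_le_mul_of_nonneg_left ?_ hκ.le))) he0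
      (fun t ht => ?_) (fun t ht => ?_) (fun t ht => ?_)
    all_goals
      have h0 := hy0 t ht
      have h1 : 0 < 1 + y t := by linarith
    · have : 1 - (1 + y t)⁻¹ = y t / (1 + y t) := by field_simp; ring
      rw [this]
      exact div_le_self h0 (by linarith)
    · have := (((hy t ht).const_add 1).fun_inv h1.ne').const_sub 1
      convert! this using 1
      ring
    · rw [div_le_iff₀ (by positivity)]
      exact hy' t ht
    · have : (1 + y t)⁻¹ ≤ 1 := inv_le_one_of_one_le₀ (by linarith)
      linarith
  have h2 : Tendsto (fun t => (1 - (1 - (1 + y t)⁻¹))⁻¹ - 1) atTop (𝓝 ((1 - 0)⁻¹ - 1)) :=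
    (((tendsto_const_nhds.sub hZ).inv₀ (by norm_num))).sub_const 1
  simpa using h2

/-! ### Energy identities at a fixed time -/

/-- `v ∈ H²(ℝ)`, with a continuously differentiable representative. -/
structure IsH2 (v : ℝ → ℝ) : Prop where
  contDiff : ContDiff ℝ 1 v
  locallyAC_deriv : LocallyAC (deriv v)
  memLp : MemLp v 2
  memLp_deriv : MemLp (deriv v) 2
  memLp_deriv_deriv : MemLp (deriv (deriv v)) 2

theorem IsH2.integral_mul_deriv_deriv {v : ℝ → ℝ} (hv : IsH2 v) :
    ∫ x, v x * deriv (deriv v) x = -∫ x, deriv v x ^ 2 := by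
  have := (LocallyAC.of_contDiff hv.contDiff).integral_deriv_mul_of_memLp hv.locallyAC_deriv
    hv.memLp hv.memLp_deriv hv.memLp_deriv hv.memLp_deriv_deriv
  simp_rw [sq]
  linarith

/-- Both sides equal -∫ v' z'. This symmetry replaces the missing time derivative of v_xx when ∫
v_x² is differentiated. -/
theorem IsH2.integral_deriv_deriv_mul_comm {v z : ℝ → ℝ} (hv : IsH2 v) (hz : IsH2 z) :
    ∫ x, v x * deriv (deriv z) x = ∫ x, z x * deriv (deriv v) x := by
  have h1 := (LocallyAC.of_contDiff hv.contDiff).integral_deriv_mul_of_memLp hz.locallyAC_deriv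
    hv.memLp hz.memLp_deriv hv.memLp_deriv hz.memLp_deriv_deriv
  have h2 := (LocallyAC.of_contDiff hz.contDiff).integral_deriv_mul_of_memLp hv.locallyAC_deriv
    hz.memLp hv.memLp_deriv hz.memLp_deriv hv.memLp_deriv_deriv
  have h3 : ∫ x, deriv z x * deriv v x = ∫ x, deriv v x * deriv z x := by simp_rw [mul_comm]
  linarith

theorem memLp_mul_of_abs_le {f g : ℝ → ℝ} (hf : Continuous f) {C : ℝ} (hC : ∀ x, |f x| ≤ C)
    (hg : MemLp g 2) : MemLp (fun x => f x * g x) 2 :=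
  hg.mul (memLp_top_of_bound hf.aestronglyMeasurable C (Eventually.of_forall hC))

/-- The difference of the Burgers nonlinearities of `ψ + v` and `ψ`. -/
def burgersIncrement (ψ v : ℝ → ℝ) (x : ℝ) : ℝ :=
  v x * deriv v x + ψ x * deriv v x + deriv ψ x * v x

theorem IsH2.memLp_burgersIncrement {v ψ : ℝ → ℝ} (hv : IsH2 v) (hψ : ContDiff ℝ 1 ψ)
    (hψ1 : MemLp (deriv ψ) 2) {B : ℝ} (hB : ∀ x, |ψ x| ≤ B) :
    MemLp (burgersIncrement ψ v) 2 := by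
  obtain ⟨C, hC⟩ := exists_abs_le_of_memLp hv.contDiff hv.memLp hv.memLp_deriv
  refine ((memLp_mul_of_abs_le hv.contDiff.continuous hC hv.memLp_deriv).add
    (memLp_mul_of_abs_le hψ.continuous hB hv.memLp_deriv)).add ?_
  refine (memLp_mul_of_abs_le hv.contDiff.continuous hC hψ1).ae_eq
    (Eventually.of_forall fun x => mul_comm _ _)

/-- The difference of the two integrands is the exact derivative of v³/3 + ½ ψ v², which is
integrable on the line. -/
theorem IsH2.integral_mul_burgersIncrement {v ψ : ℝ → ℝ} (hv : IsH2 v) (hψ : ContDiff ℝ 1 ψ)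
    (hψ1 : MemLp (deriv ψ) 2) {B : ℝ} (hB : ∀ x, |ψ x| ≤ B) :
    ∫ x, v x * burgersIncrement ψ v x = 1 / 2 * ∫ x, deriv ψ x * v x ^ 2 := by
  obtain ⟨C, hC⟩ := exists_abs_le_of_memLp hv.contDiff hv.memLp hv.memLp_deriv
  have i1 : Integrable fun x => v x * burgersIncrement ψ v x :=
    hv.memLp.integrable_mul (hv.memLp_burgersIncrement hψ hψ1 hB)
  have i2 : Integrable fun x => deriv ψ x * v x ^ 2 := by
    refine (hv.memLp.integrable_mul
      (memLp_mul_of_abs_le hv.contDiff.continuous hC hψ1)).congr (Eventually.of_forall fun x => ?_)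
    simp only [Pi.mul_apply]; ring
  have i3 : Integrable fun x => v x ^ 3 / 3 + 1 / 2 * (ψ x * v x ^ 2) := by
    have j1 : Integrable fun x => v x ^ 2 * (v x / 3 + 1 / 2 * ψ x) := by
      refine hv.memLp.integrable_sq.mul_of_abs_le (C := C / 3 + 1 / 2 * B)
        ((hv.contDiff.continuous.div_const 3).add (hψ.continuous.const_mul _)) fun x => ?_
      refine (abs_add_le _ _).trans (add_le_add ?_ ?_)
      · rw [abs_div, abs_of_pos (show (0 : ℝ) < 3 by norm_num)]
        linarith [hC x]
      · rw [abs_mul, abs_of_pos (show (0 : ℝ) < 1 / 2 by norm_num)]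
        linarith [hB x]
    refine j1.congr (Eventually.of_forall fun x => ?_)
    simp only; ring
  have hd : ∀ x, HasDerivAt (fun x => v x ^ 3 / 3 + 1 / 2 * (ψ x * v x ^ 2))
      (v x * burgersIncrement ψ v x - 1 / 2 * (deriv ψ x * v x ^ 2)) x := fun x => by
    have d1 := ((hv.contDiff.differentiable (by norm_num)).differentiableAt (x := x)).hasDerivAt
    have d2 := ((hψ.differentiable (by norm_num)).differentiableAt (x := x)).hasDerivAt
    convert! ((d1.fun_pow 3).div_const 3).add ((d2.fun_mul (d1.fun_pow 2)).const_mul (1 / 2))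
      using 1
    simp only [burgersIncrement]
    push_cast
    ring
  have h := integral_eq_zero_of_hasDerivAt_of_integrable hd (i1.sub (i2.const_mul _)) i3
  rw [integral_sub i1 (i2.const_mul _), integral_const_mul] at h
  linarith

/-- The right-hand side of the equation for the perturbation `v` of the moving front `ψ`. -/
def perturbationField (ψ v h : ℝ → ℝ) (p : ℝ) (x : ℝ) : ℝ :=
  deriv (deriv v) x + h x - burgersIncrement ψ v x + p * deriv ψ x

theorem IsH2.integral_mul_perturbationField {v ψ h : ℝ → ℝ} (hv : IsH2 v) (hψ : ContDiff ℝ 1 ψ)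
    (hψ1 : MemLp (deriv ψ) 2) {B : ℝ} (hB : ∀ x, |ψ x| ≤ B) (hh : MemLp h 2) (p : ℝ) :
    ∫ x, v x * perturbationField ψ v h p x = -(∫ x, deriv v x ^ 2) + (∫ x, h x * v x)
      - 1 / 2 * (∫ x, deriv ψ x * v x ^ 2) + p * ∫ x, deriv ψ x * v x := by
  have i1 : Integrable fun x => v x * deriv (deriv v) x :=
    hv.memLp.integrable_mul hv.memLp_deriv_deriv
  have i2 : Integrable fun x => h x * v x := hh.integrable_mul hv.memLp
  have i3 : Integrable fun x => v x * burgersIncrement ψ v x :=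
    hv.memLp.integrable_mul (hv.memLp_burgersIncrement hψ hψ1 hB)
  have i4 : Integrable fun x => p * (deriv ψ x * v x) := (hψ1.integrable_mul hv.memLp).const_mul p
  have i12 : Integrable fun x => v x * deriv (deriv v) x + h x * v x := i1.add i2
  have i123 : Integrable fun x => v x * deriv (deriv v) x + h x * v x
      - v x * burgersIncrement ψ v x := i12.sub i3
  rw [← hv.integral_mul_deriv_deriv, ← hv.integral_mul_burgersIncrement hψ hψ1 hB,
    ← integral_const_mul, ← integral_add i1 i2, ← integral_sub i12 i3, ← integral_add i123 i4]
  refine integral_congr_ae (Eventually.of_forall fun x => ?_)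
  simp only [perturbationField]
  ring

/-- The diffusion term yields -∫ v_xx², which absorbs v_xx from every product with the lower-order
terms. The multiplier term has a favorable sign and is discarded. -/
theorem IsH2.neg_integral_deriv_deriv_mul_perturbationField_le {v ψ h : ℝ → ℝ} (hv : IsH2 v)
    (hψ : ContDiff ℝ 1 ψ) (hψ1 : MemLp (deriv ψ) 2) {B : ℝ} (hB : ∀ x, |ψ x| ≤ B)
    (hh : MemLp h 2) (p : ℝ) (hdis : 0 ≤ ∫ x, h x * deriv (deriv v) x) {S : ℝ}
    (hS : ∀ x, v x ^ 2 ≤ S) :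
    -∫ x, deriv (deriv v) x * perturbationField ψ v h p x ≤
      (S + B ^ 2) * (∫ x, deriv v x ^ 2) + (S + p ^ 2) * ∫ x, deriv ψ x ^ 2 := by
  have hf : MemLp (perturbationField ψ v h p) 2 :=
    ((hv.memLp_deriv_deriv.add hh).sub (hv.memLp_burgersIncrement hψ hψ1 hB)).add (hψ1.const_mul p)
  have i0 : Integrable fun x => deriv (deriv v) x * perturbationField ψ v h p x :=
    hv.memLp_deriv_deriv.integrable_mul hf
  have i1 : Integrable fun x => h x * deriv (deriv v) x := hh.integrable_mul hv.memLp_deriv_deriv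
  have i2 : Integrable fun x => (S + B ^ 2) * deriv v x ^ 2 :=
    hv.memLp_deriv.integrable_sq.const_mul _
  have i3 : Integrable fun x => (S + p ^ 2) * deriv ψ x ^ 2 := hψ1.integrable_sq.const_mul _
  have i23 : Integrable fun x => (S + B ^ 2) * deriv v x ^ 2 + (S + p ^ 2) * deriv ψ x ^ 2 :=
    i2.add i3
  have key : ∫ x, -(deriv (deriv v) x * perturbationField ψ v h p x) ≤
      ∫ x, ((S + B ^ 2) * deriv v x ^ 2 + (S + p ^ 2) * deriv ψ x ^ 2
        - h x * deriv (deriv v) x) := by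
    refine integral_mono i0.neg (i23.sub i1) fun x => ?_
    simp only [perturbationField, burgersIncrement]
    have hb : ψ x ^ 2 ≤ B ^ 2 := sq_le_sq' (abs_le.1 (hB x)).1 (abs_le.1 (hB x)).2
    have b1 := mul_le_mul_of_nonneg_right (hS x) (sq_nonneg (deriv v x))
    have b2 := mul_le_mul_of_nonneg_right hb (sq_nonneg (deriv v x))
    have b3 := mul_le_mul_of_nonneg_right (hS x) (sq_nonneg (deriv ψ x))
    set A₁ := v x * deriv v x with hA₁
    set A₂ := ψ x * deriv v x with hA₂
    set A₃ := deriv ψ x * v x with hA₃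
    set A₄ := p * deriv ψ x with hA₄
    set D := deriv (deriv v) x
    have c1 : A₁ ^ 2 = v x ^ 2 * deriv v x ^ 2 := by rw [hA₁]; ring
    have c2 : A₂ ^ 2 = ψ x ^ 2 * deriv v x ^ 2 := by rw [hA₂]; ring
    have c3 : A₃ ^ 2 = v x ^ 2 * deriv ψ x ^ 2 := by rw [hA₃]; ring
    have c4 : A₄ ^ 2 = p ^ 2 * deriv ψ x ^ 2 := by rw [hA₄]; ring
    -- Young's inequality D X ≤ D² + X²/4, followed by X² ≤ 4 ∑ Aᵢ² for a sum of four terms.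
    have d1 : D * (A₁ + A₂ + A₃ - A₄) ≤ D ^ 2 + (A₁ ^ 2 + A₂ ^ 2 + A₃ ^ 2 + A₄ ^ 2) := by
      nlinarith [sq_nonneg (2 * D - (A₁ + A₂ + A₃ - A₄)), sq_nonneg (A₁ - A₂), sq_nonneg (A₁ - A₃),
        sq_nonneg (A₁ + A₄), sq_nonneg (A₂ - A₃), sq_nonneg (A₂ + A₄), sq_nonneg (A₃ + A₄)]
    linarith
  rw [integral_neg, integral_sub i23 i1, integral_add i2 i3, integral_const_mul,
    integral_const_mul] at key
  linarith

/-! ### Decay in `L^p` -/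

/-- For finite p, interpolation: |f|^p ≤ δ^{p-2} |f|² once |f| ≤ δ, and p > 2 makes the prefactor
vanish with δ. -/
theorem tendsto_eLpNorm_zero_of_uniform {f : ℝ → ℝ → ℝ} {M : ℝ≥0∞} (hM : M ≠ ∞)
    (h2 : ∀ᶠ t in atTop, ∫⁻ x, ‖f t x‖ₑ ^ 2 ≤ M)
    (hunif : ∀ δ : ℝ, 0 < δ → ∀ᶠ t in atTop, ∀ x, |f t x| ≤ δ) {p : ℝ≥0∞} (hp : 2 < p) :
    Tendsto (fun t => eLpNorm (f t) p volume) atTop (𝓝 0) := by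
  rw [ENNReal.tendsto_nhds_zero]
  intro ε hε
  rcases eq_or_ne p ∞ with rfl | hp'
  · obtain ⟨δ, hδ, hδε⟩ : ∃ δ : ℝ, 0 < δ ∧ ENNReal.ofReal δ ≤ ε := by
      obtain ⟨r, hr, hrε⟩ := ENNReal.lt_iff_exists_nnreal_btwn.1 hε
      exact ⟨r, by simpa using hr, by simpa using hrε.le⟩
    filter_upwards [hunif δ hδ] with t ht
    rw [eLpNorm_exponent_top]
    exact (eLpNormEssSup_le_of_ae_bound (Eventually.of_forall ht)).trans hδε
  · have hp0 : p ≠ 0 := (lt_trans (by norm_num) hp).ne'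
    set r := p.toReal
    have hr : 2 < r := by
      have := (ENNReal.toReal_lt_toReal (by norm_num) hp').2 hp
      simpa using this
    have hlim : Tendsto (fun δ : ℝ => ((ENNReal.ofReal δ) ^ (r - 2) * M) ^ (1 / r)) (𝓝[>] 0)
        (𝓝 0) := by
      have h1 : Tendsto (fun δ : ℝ => ENNReal.ofReal δ) (𝓝[>] 0) (𝓝 0) := by
        simpa using (ENNReal.continuous_ofReal.tendsto 0).mono_left nhdsWithin_le_nhds
      have h3 := (ENNReal.continuous_rpow_const (y := r - 2)).tendsto 0 |>.comp h1
      rw [ENNReal.zero_rpow_of_pos (by linarith)] at h3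
      have h4 := ENNReal.Tendsto.mul_const (b := M) h3 (Or.inr hM)
      rw [zero_mul] at h4
      have h5 := (ENNReal.continuous_rpow_const (y := 1 / r)).tendsto 0 |>.comp h4
      rwa [ENNReal.zero_rpow_of_pos (by positivity)] at h5
    obtain ⟨δ, hδε, hδ⟩ := ((ENNReal.tendsto_nhds_zero.1 hlim ε hε).and
      self_mem_nhdsWithin).exists
    filter_upwards [hunif δ hδ, h2] with t ht ht2
    refine le_trans ?_ hδε
    rw [eLpNorm_eq_lintegral_rpow_enorm_toReal hp0 hp']
    refine ENNReal.rpow_le_rpow ?_ (by positivity)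
    calc ∫⁻ x, ‖f t x‖ₑ ^ r ≤ ∫⁻ x, (ENNReal.ofReal δ) ^ (r - 2) * ‖f t x‖ₑ ^ 2 := by
          refine lintegral_mono fun x => ?_
          have h6 : ‖f t x‖ₑ ≤ ENNReal.ofReal δ := by
            rw [← ofReal_norm]
            exact ENNReal.ofReal_le_ofReal (ht x)
          calc ‖f t x‖ₑ ^ r = ‖f t x‖ₑ ^ ((r - 2) + 2) := by ring_nf
            _ = ‖f t x‖ₑ ^ (r - 2) * ‖f t x‖ₑ ^ (2 : ℝ) :=
              ENNReal.rpow_add_of_nonneg _ _ (by linarith) (by norm_num)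
            _ ≤ _ := by
              rw [ENNReal.rpow_ofNat]
              gcongr
      _ = (ENNReal.ofReal δ) ^ (r - 2) * ∫⁻ x, ‖f t x‖ₑ ^ 2 :=
        lintegral_const_mul' _ _ (ENNReal.rpow_ne_top_of_nonneg (by linarith)
          ENNReal.ofReal_ne_top)
      _ ≤ _ := by gcongr

/-! ### The perturbation of a moving front -/

theorem inner_eq_integral_mul {F G : Lp ℝ 2 (volume : Measure ℝ)} {f g : ℝ → ℝ}
    (hF : F =ᵐ[volume] f) (hG : G =ᵐ[volume] g) : inner ℝ F G = ∫ x, f x * g x := by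
  rw [L2.inner_def]
  refine integral_congr_ae ?_
  filter_upwards [hF, hG] with x h1 h2
  rw [h1, h2]
  simp [mul_comm]

theorem exists_abs_le_of_tendsto {f : ℝ → ℝ} (hf : Continuous f) {a b : ℝ}
    (ha : Tendsto f atTop (𝓝 a)) (hb : Tendsto f atBot (𝓝 b)) : ∃ B, ∀ x, |f x| ≤ B := by
  obtain ⟨s, hs⟩ := eventually_atTop.1 (ha.abs.eventually_le_const (lt_add_one |a|))
  obtain ⟨r, hr⟩ := eventually_atBot.1 (hb.abs.eventually_le_const (lt_add_one |b|))
  obtain ⟨C, hC⟩ := (isCompact_Icc (a := r) (b := s)).exists_bound_of_continuousOn hf.continuousOn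
  refine ⟨max C (max (|a| + 1) (|b| + 1)), fun x => ?_⟩
  rcases le_total s x with h | h
  · exact (hs x h).trans ((le_max_left _ _).trans (le_max_right _ _))
  rcases le_total x r with h' | h'
  · exact (hr x h').trans ((le_max_right _ _).trans (le_max_right _ _))
  · exact (hC x ⟨h', h⟩).trans (le_max_left _ _)

open scoped NNReal in
/-- Existence of the phase shift, defined by `x₀' = -¼ ⟪φ'(· - x₀), u - φ(· - x₀)⟫`. -/
theorem exists_phase {φ : ℝ → ℝ} (hφ : LocallyAC φ) (hφ' : LocallyAC (deriv φ))
    (m1 : MemLp (deriv φ) 2) (m2 : MemLp (deriv (deriv φ)) 2) (h0 : Integrable (deriv φ))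
    {B : ℝ} (hB : ∀ x, |φ x| ≤ B) {w : ℝ → Lp ℝ 2 (volume : Measure ℝ)}
    (hw : ContinuousOn w (Ici 0)) :
    ∃ α : ℝ → ℝ, ∀ t : ℝ, 0 < t → HasDerivAt α
      (-(1 / 4) * inner ℝ (translate (α t) m1.toLp) (w t + hφ.increment m1 (α t))) t := by
  have hq : |(-(1 / 4) : ℝ)| = 1 / 4 := by rw [abs_neg, abs_of_pos (by norm_num)]
  have hB0 : 0 ≤ B := (abs_nonneg _).trans (hB 0)
  have hwb : ∀ T : ℝ, ∃ W : ℝ, 0 ≤ W ∧ ∀ t ∈ Icc 0 T, ‖w t‖ ≤ W := fun T => by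
    obtain ⟨W, hW⟩ := (isCompact_Icc (a := 0) (b := T)).exists_bound_of_continuousOn
      (hw.mono fun t ht => ht.1)
    exact ⟨max W 0, le_max_right _ _, fun t ht => (hW t ht).trans (le_max_left _ _)⟩
  -- The estimate for the L² norm of φ - φ(· - a) grows with a, so Cauchy–Schwarz would not bound
  -- the field uniformly. Pairing φ' in L¹ with the bounded front does.
  have hP : ∀ a, |inner ℝ (translate a m1.toLp) (hφ.increment m1 a)| ≤
      (∫ x, |deriv φ x|) * (B + B) := fun a => by
    rw [inner_eq_integral_mul (translate_ae_eq a m1.coeFn_toLp) (hφ.increment_ae_eq m1 a),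
      ← integral_sub_right_eq_self (fun x => |deriv φ x|) a, ← integral_mul_const]
    refine abs_integral_le_integral_abs.trans (integral_mono_of_nonneg
      (Eventually.of_forall fun x => abs_nonneg _) ((h0.abs.comp_sub_right a).mul_const _)
      (Eventually.of_forall fun x => ?_))
    simp only [abs_mul]
    exact mul_le_mul_of_nonneg_left ((abs_sub _ _).trans (add_le_add (hB _) (hB _))) (abs_nonneg _)
  refine exists_global_integralCurve
    (F := fun t a => -(1 / 4) * inner ℝ (translate a m1.toLp) (w t + hφ.increment m1 a))
    (fun a => (continuousOn_const.inner (hw.add continuousOn_const)).const_mul _)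
    (fun T => ?_) (fun T R => ?_)
  · obtain ⟨W, hW0, hW⟩ := hwb T
    refine ⟨.mk (1 / 4 * (‖m1.toLp‖ * W + (∫ x, |deriv φ x|) * (B + B))) ?_, fun t ht a => ?_⟩
    · have := integral_nonneg (μ := volume) (f := fun x => |deriv φ x|) fun x => abs_nonneg _
      positivity
    · rw [NNReal.coe_mk, norm_mul, inner_add_right, Real.norm_eq_abs, Real.norm_eq_abs, hq]
      refine mul_le_mul_of_nonneg_left ?_ (by norm_num)
      refine (abs_add_le _ _).trans (add_le_add ?_ (hP a))
      refine (abs_real_inner_le_norm _ _).trans ?_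
      rw [LinearIsometry.norm_map]
      exact mul_le_mul_of_nonneg_left (hW t ht) (norm_nonneg _)
  · obtain ⟨W, hW0, hW⟩ := hwb T
    refine ⟨.mk (1 / 4 * (‖m2.toLp‖ * (W + ‖m1.toLp‖ * |R|) + ‖m1.toLp‖ * ‖m1.toLp‖))
      (by positivity),
      fun t ht => LipschitzOnWith.of_dist_le_mul fun a ha b hb => ?_⟩
    -- Written this way, the translates of φ' inherit Lipschitz dependence on a from increments of
    -- φ', whose derivative φ'' is in L².
    have e : ∀ a, translate a m1.toLp = m1.toLp - hφ'.increment m2 a := fun a => by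
      refine Lp.ext ((translate_ae_eq a m1.coeFn_toLp).trans ?_)
      filter_upwards [Lp.coeFn_sub m1.toLp (hφ'.increment m2 a), m1.coeFn_toLp,
        hφ'.increment_ae_eq m2 a] with x h1 h2 h3
      rw [h1, Pi.sub_apply, h2, h3]
      ring
    have n1 : ‖translate a m1.toLp - translate b m1.toLp‖ ≤ ‖m2.toLp‖ * |a - b| := by
      rw [e a, e b, sub_sub_sub_cancel_left, norm_sub_rev]
      exact hφ'.increment_sub_le m2 a b
    have n2 : ‖w t + hφ.increment m1 a‖ ≤ W + ‖m1.toLp‖ * |R| := by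
      refine (norm_add_le _ _).trans (add_le_add (hW t ht) ?_)
      have := hφ.increment_sub_le m1 a 0
      rw [hφ.increment_zero, sub_zero, sub_zero] at this
      refine this.trans (mul_le_mul_of_nonneg_left ?_ (norm_nonneg _))
      rw [Metric.mem_closedBall, Real.dist_eq, sub_zero] at ha
      exact ha.trans (le_abs_self R)
    have n3 : ‖hφ.increment m1 a - hφ.increment m1 b‖ ≤ ‖m1.toLp‖ * |a - b| :=
      hφ.increment_sub_le m1 a b
    have split : -(1 / 4) * inner ℝ (translate a m1.toLp) (w t + hφ.increment m1 a)
        - -(1 / 4) * inner ℝ (translate b m1.toLp) (w t + hφ.increment m1 b)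
        = -(1 / 4) * (inner ℝ (translate a m1.toLp - translate b m1.toLp)
            (w t + hφ.increment m1 a)
          + inner ℝ (translate b m1.toLp) (hφ.increment m1 a - hφ.increment m1 b)) := by
      simp only [inner_sub_left, inner_sub_right, inner_add_right]
      ring
    rw [Real.dist_eq, Real.dist_eq, split, abs_mul, NNReal.coe_mk, mul_assoc, hq]
    refine mul_le_mul_of_nonneg_left ?_ (by norm_num)
    refine (abs_add_le _ _).trans ?_
    have k1 := (abs_real_inner_le_norm (translate a m1.toLp - translate b m1.toLp)
      (w t + hφ.increment m1 a)).trans (mul_le_mul n1 n2 (norm_nonneg _) (by positivity))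
    have k2 := (abs_real_inner_le_norm (translate b m1.toLp)
      (hφ.increment m1 a - hφ.increment m1 b))
    rw [LinearIsometry.norm_map] at k2
    have k3 := k2.trans (mul_le_mul_of_nonneg_left n3 (norm_nonneg _))
    linarith

theorem deriv_comp_sub_const_eq (f : ℝ → ℝ) (a : ℝ) :
    deriv (fun x => f (x - a)) = fun x => deriv f (x - a) :=
  funext fun x => deriv_comp_sub_const f a x

theorem ae_comp_sub_const {p : ℝ → Prop} (h : ∀ᵐ x : ℝ, p x) (a : ℝ) : ∀ᵐ x : ℝ, p (x - a) :=
  (measurePreserving_sub_right volume a).quasiMeasurePreserving.ae h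

theorem ae_deriv_deriv_sub_eq {u φ : ℝ → ℝ} (hu : IsH2Loc u) (hφ : IsH2Loc φ) (a : ℝ) :
    (∀ x, deriv (fun x => u x - φ (x - a)) x = deriv u x - deriv φ (x - a)) ∧
    ∀ᵐ x, deriv (deriv fun x => u x - φ (x - a)) x
      = deriv (deriv u) x - deriv (deriv φ) (x - a) := by
  have hd : ∀ x, deriv (fun x => u x - φ (x - a)) x = deriv u x - deriv φ (x - a) := fun x => by
    have h2 : DifferentiableAt ℝ (fun x => φ (x - a)) x :=
      ((hφ.1.differentiable (by norm_num)).comp (differentiable_id.sub_const a)).differentiableAt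
    rw [deriv_fun_sub (hu.1.differentiable (by norm_num)).differentiableAt h2,
      deriv_comp_sub_const]
  refine ⟨hd, ?_⟩
  rw [funext hd]
  have hφ2 : LocallyAC fun x => deriv φ (x - a) := LocallyAC.comp_sub_const hφ.2 a
  filter_upwards [LocallyAC.ae_differentiableAt hu.2, hφ2.ae_differentiableAt] with x h1 h2
  rw [deriv_fun_sub h1 h2, deriv_comp_sub_const]

/-- Everything that is needed about the perturbation `v = u(t) - φ(· - a)` at a fixed time. -/
theorem perturbation_at_time {ℓ : ℝ → ℂ} (hℓ : ∀ k, (ℓ k).re ≤ 0) {φ : ℝ → ℝ} (hφ : IsFront ℓ φ)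
    {u : ℝ → ℝ} (hu : IsH2Loc u) {w wxx ut : Lp ℝ 2 (volume : Measure ℝ)}
    (hw : w =ᵐ[volume] fun x => u x - φ x)
    (hwxx : wxx =ᵐ[volume] fun x => deriv (deriv u) x - deriv (deriv φ) x)
    (heq : ∃ Lu : ℝ → ℝ, IsMultiplierImage ℓ u Lu ∧
      ∀ᵐ x : ℝ, ut x + u x * deriv u x = deriv (deriv u) x + Lu x) (a : ℝ) :
    IsH2 (fun x => u x - φ (x - a)) ∧ ∃ h : ℝ → ℝ, MemLp h 2 ∧
      ∫ x, h x * (u x - φ (x - a)) ≤ 0 ∧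
      0 ≤ ∫ x, h x * deriv (deriv fun x => u x - φ (x - a)) x ∧
      ∀ p : ℝ, ∀ᵐ x : ℝ, ut x + p * deriv φ (x - a) =
        perturbationField (fun x => φ (x - a)) (fun x => u x - φ (x - a)) h p x := by
  obtain ⟨Lu, hLu, hut⟩ := heq
  obtain ⟨Lφ, hLφ, hφeq⟩ := hφ.equation
  obtain ⟨hd, hdd⟩ := ae_deriv_deriv_sub_eq hu hφ.isH2Loc a
  have hmp := measurePreserving_sub_right (volume : Measure ℝ) a
  have hφac : LocallyAC φ := LocallyAC.of_contDiff hφ.isH2Loc.1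
  have hv : IsH2 (fun x => u x - φ (x - a)) := by
    refine ⟨hu.1.sub (hφ.isH2Loc.1.comp (contDiff_id.sub contDiff_const)), ?_, ?_, ?_, ?_⟩
    · rw [funext hd]
      exact LocallyAC.sub hu.2 (LocallyAC.comp_sub_const hφ.isH2Loc.2 a)
    · refine (((Lp.memLp w).ae_eq hw).add
        (hφac.memLp_sub_translate hφ.memLp_deriv a)).ae_eq (Eventually.of_forall fun x => ?_)
      simp
    · rw [funext hd]
      exact hLu.memLp.1.sub (hφ.memLp_deriv.comp_measurePreserving hmp)
    · refine (((Lp.memLp wxx).ae_eq hwxx).add (hφ.memLp_deriv_deriv.sub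
        (hφ.memLp_deriv_deriv.comp_measurePreserving hmp))).ae_eq ?_
      filter_upwards [hdd] with x hx
      rw [hx]
      simp
  have hmul := hLu.sub (hLφ.comp_sub_const a)
  refine ⟨hv, fun x => Lu x - Lφ (x - a), hmul.memLp.2, hmul.integral_mul_nonpos hℓ hv.memLp,
    hmul.integral_mul_deriv_deriv_nonneg hℓ hv.memLp hv.locallyAC_deriv hv.memLp_deriv_deriv,
    fun p => ?_⟩
  -- The front equation is translation invariant, so its translate may be subtracted from the
  -- equation for u.
  filter_upwards [hdd, hut, ae_comp_sub_const hφeq a] with x h1 h2 h3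
  simp only [perturbationField, burgersIncrement, h1, hd, deriv_comp_sub_const_eq]
  linear_combination h2 - h3

/-! ### Asymptotic stability -/

/-- By symmetry the cross terms cancel in ⟪V s - V t, A s + A t⟫, which therefore equals ⟪V s, A s⟫
- ⟪V t, A t⟫. Only V has to be differentiable; continuity of A is enough. -/
theorem hasDerivAt_neg_inner_of_symm {H : Type*} [NormedAddCommGroup H] [InnerProductSpace ℝ H]
    {V A : ℝ → H} {V' : H} {t : ℝ} (hV : HasDerivAt V V' t) (hA : ContinuousAt A t)
    (hsymm : ∀ᶠ s in 𝓝 t, (inner ℝ (V s) (A t) : ℝ) = inner ℝ (V t) (A s)) :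
    HasDerivAt (fun s => -(inner ℝ (V s) (A s) : ℝ)) (-(2 * inner ℝ V' (A t))) t := by
  rw [hasDerivAt_iff_tendsto_slope] at hV ⊢
  have hlim : Tendsto (fun s => -(inner ℝ (slope V t s) (A s + A t) : ℝ)) (𝓝[≠] t)
      (𝓝 (-(inner ℝ V' (A t + A t) : ℝ))) :=
    (hV.inner ((hA.tendsto.mono_left nhdsWithin_le_nhds).add_const (A t))).neg
  have e : -(inner ℝ V' (A t + A t) : ℝ) = -(2 * inner ℝ V' (A t)) := by
    rw [inner_add_right]; ring
  rw [e] at hlim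
  refine hlim.congr' ?_
  filter_upwards [hsymm.filter_mono nhdsWithin_le_nhds] with s hs
  rw [slope_def_module, slope_def_module, real_inner_smul_left, smul_eq_mul, inner_sub_left,
    inner_add_right, inner_add_right, hs]
  ring

theorem coercive_comp_sub_const {φ : ℝ → ℝ} {κ : ℝ}
    (H : ∀ v : ℝ → ℝ, ContDiff ℝ 1 v → MemLp v 2 → MemLp (deriv v) 2 →
      κ * ∫ x, deriv v x ^ 2 ≤ (∫ x, deriv v x ^ 2) + 1 / 2 * (∫ x, deriv φ x * v x ^ 2)
        + 1 / 4 * (∫ x, deriv φ x * v x) ^ 2) {v : ℝ → ℝ} (hv : IsH2 v) (a : ℝ) :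
    κ * ∫ x, deriv v x ^ 2 ≤ (∫ x, deriv v x ^ 2) + 1 / 2 * (∫ x, deriv φ (x - a) * v x ^ 2)
        + 1 / 4 * (∫ x, deriv φ (x - a) * v x) ^ 2 := by
  have hd : deriv (fun x => v (x + a)) = fun x => deriv v (x + a) :=
    funext fun x => deriv_comp_add_const v a x
  have hmp := measurePreserving_add_right (volume : Measure ℝ) a
  have h := H (fun x => v (x + a)) (hv.contDiff.comp (contDiff_id.add contDiff_const))
    (hv.memLp.comp_measurePreserving hmp)
    (by rw [hd]; exact hv.memLp_deriv.comp_measurePreserving hmp)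
  rw [hd] at h
  have e1 := integral_add_right_eq_self (μ := volume) (fun x => deriv v x ^ 2) a
  have e2 := integral_add_right_eq_self (μ := volume) (fun x => deriv φ (x - a) * v x ^ 2) a
  have e3 := integral_add_right_eq_self (μ := volume) (fun x => deriv φ (x - a) * v x) a
  simp only [add_sub_cancel_right] at e2 e3
  rw [← e1, ← e2, ← e3]
  exact h

theorem lintegral_enorm_sq_eq {f : ℝ → ℝ} (hf : MemLp f 2) :
    ∫⁻ x, ‖f x‖ₑ ^ 2 = ENNReal.ofReal (∫ x, f x ^ 2) := by
  rw [ofReal_integral_eq_lintegral_ofReal hf.integrable_sq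
    (Eventually.of_forall fun x => sq_nonneg _)]
  refine lintegral_congr fun x => ?_
  rw [← ofReal_norm, ← ENNReal.ofReal_pow (norm_nonneg _), Real.norm_eq_abs, sq_abs]

theorem eLpNorm_two_sq_eq {f : ℝ → ℝ} (hf : MemLp f 2) :
    eLpNorm f 2 volume ^ 2 = ENNReal.ofReal (∫ x, f x ^ 2) := by
  rw [← lintegral_enorm_sq_eq hf]
  simpa using! eLpNorm_nnreal_pow_eq_lintegral (μ := volume) (f := f) (p := 2) (by norm_num)

/-- The bound on the growth of `∫ v_x²` along the flow. -/
theorem growth_bound {E A B y p : ℝ} (hE : 0 ≤ E) (hA : 0 ≤ A) (hy : 0 ≤ y)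
    (hp : p ^ 2 ≤ A * E) :
    (E + y + B ^ 2) * y + (E + y + p ^ 2) * A ≤
      ((E + 1) + B ^ 2 + (E + 1) * A + A * E * A) * (1 + y) ^ 2 := by
  have h1 : E + y ≤ (E + 1) * (1 + y) := by nlinarith [mul_nonneg hE hy]
  have h2 : 1 + y ≤ (1 + y) ^ 2 := by nlinarith
  have h3 : (E + y) * y ≤ (E + 1) * (1 + y) ^ 2 := by
    have := mul_le_mul h1 (show y ≤ 1 + y by linarith) hy (by positivity)
    linarith
  have h4 : B ^ 2 * y ≤ B ^ 2 * (1 + y) ^ 2 :=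
    mul_le_mul_of_nonneg_left (by linarith) (sq_nonneg B)
  have h5 : (E + y) * A ≤ (E + 1) * A * (1 + y) ^ 2 := by
    have h6 : E + y ≤ (E + 1) * (1 + y) ^ 2 :=
      h1.trans (mul_le_mul_of_nonneg_left h2 (by positivity))
    have := mul_le_mul_of_nonneg_right h6 hA
    linarith
  have h7 : p ^ 2 * A ≤ A * E * A * (1 + y) ^ 2 := by
    have h8 := mul_le_mul_of_nonneg_right hp hA
    have h9 : A * E * A * 1 ≤ A * E * A * (1 + y) ^ 2 :=
      mul_le_mul_of_nonneg_left (by linarith) (by positivity)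
    linarith
  linarith

theorem IsFront.isAsymptoticallyStable {ℓ : ℝ → ℂ} (hℓ : ∀ k : ℝ, (ℓ k).re ≤ 0) {φ : ℝ → ℝ}
    (hφ : IsFront ℓ φ) (hint : Integrable (fun x : ℝ => (1 + |x|) * deriv φ x))
    (hτ : tau (fun x : ℝ => 1 / 2 * deriv φ x) < 1) : IsAsymptoticallyStable ℓ φ := by
  rintro u₀ u ⟨-, hu, w, wxx, ut, hw, hwxx, hwc, hwxxc, -, hwd, heq⟩
  have hφ1 : LocallyAC φ := LocallyAC.of_contDiff hφ.isH2Loc.1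
  have hφ2 : LocallyAC (deriv φ) := hφ.isH2Loc.2
  have m1 := hφ.memLp_deriv
  have m2 := hφ.memLp_deriv_deriv
  obtain ⟨h0, κ, hκ, hcoer⟩ :=
    exists_coercive_of_sharp hφ.isH2Loc.1 hφ.tendsto_atTop hφ.tendsto_atBot hint hτ
  obtain ⟨B, hB⟩ := exists_abs_le_of_tendsto hφ1.continuous hφ.tendsto_atTop hφ.tendsto_atBot
  obtain ⟨α, hα⟩ := exists_phase hφ1 hφ2 m1 m2 h0 hB hwc
  set V : ℝ → Lp ℝ 2 (volume : Measure ℝ) := fun t => w t + hφ1.increment m1 (α t) with hVdef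
  set D : ℝ → Lp ℝ 2 (volume : Measure ℝ) := fun t => translate (α t) m1.toLp with hDdef
  set p : ℝ → ℝ := fun t => -(1 / 4) * inner ℝ (D t) (V t) with hpdef
  set Vt : ℝ → Lp ℝ 2 (volume : Measure ℝ) := fun t => ut t + p t • D t with hVtdef
  set Vxx : ℝ → Lp ℝ 2 (volume : Measure ℝ) :=
    fun t => wxx t + (m2.toLp - translate (α t) m2.toLp) with hVxxdef
  set v : ℝ → ℝ → ℝ := fun t x => u t x - φ (x - α t) with hvdef
  have hψ : ∀ t, ContDiff ℝ 1 fun x => φ (x - α t) := fun t =>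
    hφ.isH2Loc.1.comp (contDiff_id.sub contDiff_const)
  have hψd : ∀ t, deriv (fun x => φ (x - α t)) = fun x => deriv φ (x - α t) := fun t =>
    deriv_comp_sub_const_eq φ (α t)
  have hψ1 : ∀ t, MemLp (deriv fun x => φ (x - α t)) 2 := fun t => by
    rw [hψd]
    exact m1.comp_measurePreserving (measurePreserving_sub_right volume (α t))
  have hDae : ∀ t, D t =ᵐ[volume] fun x => deriv φ (x - α t) := fun t =>
    translate_ae_eq (α t) m1.coeFn_toLp
  have hpert := fun t (ht : 0 < t) =>
    perturbation_at_time hℓ hφ (hu t ht) (hw t ht.le) (hwxx t ht) (heq t ht) (α t)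
  have hv : ∀ t, 0 < t → IsH2 (v t) := fun t ht => (hpert t ht).1
  have hdv : ∀ t, 0 < t → ∀ x, deriv (v t) x = deriv (u t) x - deriv φ (x - α t) := fun t ht =>
    (ae_deriv_deriv_sub_eq (hu t ht) hφ.isH2Loc (α t)).1
  have hVae : ∀ t, 0 < t → V t =ᵐ[volume] v t := fun t ht => by
    filter_upwards [Lp.coeFn_add (w t) (hφ1.increment m1 (α t)), hw t ht.le,
      hφ1.increment_ae_eq m1 (α t)] with x h1 h2 h3
    rw [h1, Pi.add_apply, h2, h3]
    simp only [hvdef]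
    ring
  have hVxxae : ∀ t, 0 < t → Vxx t =ᵐ[volume] deriv (deriv (v t)) := fun t ht => by
    filter_upwards [Lp.coeFn_add (wxx t) (m2.toLp - translate (α t) m2.toLp), hwxx t ht,
      Lp.coeFn_sub m2.toLp (translate (α t) m2.toLp), m2.coeFn_toLp,
      translate_ae_eq (α t) m2.coeFn_toLp,
      (ae_deriv_deriv_sub_eq (hu t ht) hφ.isH2Loc (α t)).2] with x h1 h2 h3 h4 h5 h6
    rw [h1, Pi.add_apply, h2, h3, Pi.sub_apply, h4, h5, h6]
    ring
  have hVtae : ∀ t, ∀ᵐ x, Vt t x = ut t x + p t * deriv φ (x - α t) := fun t => by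
    filter_upwards [Lp.coeFn_add (ut t) (p t • D t), Lp.coeFn_smul (p t) (D t), hDae t]
      with x h1 h2 h3
    rw [h1, Pi.add_apply, h2, Pi.smul_apply, h3, smul_eq_mul]
  have hVd : ∀ t, 0 < t → HasDerivAt V (Vt t) t := fun t ht =>
    (hwd t ht).add ((hφ1.hasDerivAt_increment m1 (α t)).scomp t (hα t ht))
  have hVxxc : ∀ t, 0 < t → ContinuousAt Vxx t := fun t ht =>
    (hwxxc.continuousAt (Ioi_mem_nhds ht)).add (continuousAt_const.sub
      ((continuous_translate m2.toLp).continuousAt.comp (hα t ht).continuousAt))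
  set e : ℝ → ℝ := fun t => ‖V t‖ ^ 2 with hedef
  set y : ℝ → ℝ := fun t => -(inner ℝ (V t) (Vxx t) : ℝ) with hydef
  have he : ∀ t, 0 < t → e t = ∫ x, v t x ^ 2 := fun t ht => by
    simp only [hedef]
    rw [← real_inner_self_eq_norm_sq, inner_eq_integral_mul (hVae t ht) (hVae t ht)]
    simp_rw [sq]
  have hy : ∀ t, 0 < t → y t = ∫ x, deriv (v t) x ^ 2 := fun t ht => by
    simp only [hydef]
    rw [inner_eq_integral_mul (hVae t ht) (hVxxae t ht), (hv t ht).integral_mul_deriv_deriv,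
      neg_neg]
  have hy0 : ∀ t, 0 < t → 0 ≤ y t := fun t ht => by
    rw [hy t ht]
    exact integral_nonneg fun x => sq_nonneg _
  have hed : ∀ t, 0 < t → HasDerivAt e (2 * inner ℝ (V t) (Vt t)) t := fun t ht =>
    (hVd t ht).norm_sq
  have hyd : ∀ t, 0 < t → HasDerivAt y (-(2 * inner ℝ (Vt t) (Vxx t))) t := fun t ht => by
    refine hasDerivAt_neg_inner_of_symm (hVd t ht) (hVxxc t ht) ?_
    filter_upwards [Ioi_mem_nhds ht] with s hs
    rw [inner_eq_integral_mul (hVae s hs) (hVxxae t ht),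
      inner_eq_integral_mul (hVae t ht) (hVxxae s hs)]
    exact (hv s hs).integral_deriv_deriv_mul_comm (hv t ht)
  have hDV : ∀ t, 0 < t → inner ℝ (D t) (V t) = ∫ x, deriv φ (x - α t) * v t x := fun t ht =>
    inner_eq_integral_mul (hDae t) (hVae t ht)
  -- The phase law turns p ∫ ψ' v into -¼ (∫ ψ' v)², exactly the rank-one term in the coercive form.
  have hed' : ∀ t, 0 < t → 2 * inner ℝ (V t) (Vt t) ≤ -(2 * κ * y t) := fun t ht => by
    obtain ⟨-, h, hh, hneg, -, hfield⟩ := hpert t ht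
    have hVt : Vt t =ᵐ[volume] perturbationField (fun x => φ (x - α t)) (v t) h (p t) := by
      filter_upwards [hVtae t, hfield (p t)] with x h1 h2
      rw [h1, h2]
    rw [inner_eq_integral_mul (hVae t ht) hVt,
      (hv t ht).integral_mul_perturbationField (hψ t) (hψ1 t) (fun x => hB _) hh, hψd, hy t ht]
    have hc := coercive_comp_sub_const hcoer (hv t ht) (α t)
    have hp : p t = -(1 / 4) * ∫ x, deriv φ (x - α t) * v t x := by
      simp only [hpdef]; rw [hDV t ht]
    rw [hp]
    have hneg' : ∫ x, h x * v t x ≤ 0 := hneg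
    linarith
  -- Time 1 serves as the reference because derivatives are available only for positive times.
  have hanti : ∀ t, 1 < t → e t ≤ e 1 := fun t ht => by
    have := sub_le_mul_sub_of_hasDerivAt hed one_pos ht.le (C := 0) fun r hr => by
      have hr0 : 0 < r := one_pos.trans_le hr.1
      exact (hed' r hr0).trans
        (neg_nonpos.2 (mul_nonneg (by positivity) (hy0 r hr0)))
    linarith
  set A : ℝ := ‖m1.toLp‖ ^ 2 with hAdef
  have hDnorm : ∀ t, ‖D t‖ ^ 2 = A := fun t => by
    simp only [hDdef, hAdef, LinearIsometry.norm_map]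
  have hA : ∀ t, ∫ x, deriv (fun x => φ (x - α t)) x ^ 2 = A := fun t => by
    rw [← hDnorm t, ← real_inner_self_eq_norm_sq, inner_eq_integral_mul (hDae t) (hDae t), hψd]
    simp_rw [sq]
  have he0 : ∀ t, 0 ≤ e t := fun t => sq_nonneg _
  have hA0 : 0 ≤ A := sq_nonneg _
  have hyd' : ∀ t, 1 < t → -(2 * inner ℝ (Vt t) (Vxx t)) ≤
      (2 * ((e 1 + 1) + B ^ 2 + (e 1 + 1) * A + A * e 1 * A)) * (1 + y t) ^ 2 := fun t ht1 => by
    have ht : 0 < t := one_pos.trans ht1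
    obtain ⟨-, h, hh, -, hpos, hfield⟩ := hpert t ht
    have hVt : Vt t =ᵐ[volume] perturbationField (fun x => φ (x - α t)) (v t) h (p t) := by
      filter_upwards [hVtae t, hfield (p t)] with x h1 h2
      rw [h1, h2]
    have hS : ∀ x, v t x ^ 2 ≤ e 1 + y t := fun x => by
      have := sq_le_integral_sq_add (hv t ht).contDiff (hv t ht).memLp (hv t ht).memLp_deriv x
      rw [← he t ht, ← hy t ht] at this
      linarith [hanti t ht1]
    have hb := (hv t ht).neg_integral_deriv_deriv_mul_perturbationField_le (hψ t) (hψ1 t)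
      (fun x => hB _) hh (p t) hpos hS
    rw [← inner_eq_integral_mul (hVxxae t ht) hVt, real_inner_comm, ← hy t ht, hA] at hb
    have hp : p t ^ 2 ≤ A * e 1 := by
      have h1 : (inner ℝ (D t) (V t) : ℝ) ^ 2 ≤ A * e t := by
        rw [← hDnorm t, hedef, ← mul_pow, ← sq_abs]
        exact pow_le_pow_left₀ (abs_nonneg _) (abs_real_inner_le_norm _ _) 2
      have h2 : A * e t ≤ A * e 1 := mul_le_mul_of_nonneg_left (hanti t ht1) hA0
      have h3 : p t ^ 2 = 1 / 16 * (inner ℝ (D t) (V t) : ℝ) ^ 2 := by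
        simp only [hpdef]; ring
      rw [h3]
      linarith [sq_nonneg (inner ℝ (D t) (V t) : ℝ)]
    have hg := growth_bound (B := B) (he0 1) hA0 (hy0 t ht) hp
    linarith
  have hylim : Tendsto y atTop (𝓝 0) :=
    tendsto_zero_of_lyapunov_of_le_sq (t₀ := 1) (κ := 2 * κ) (by positivity)
      (by have := he0 1; positivity)
      (fun t ht => hed t (one_pos.trans ht)) (fun t ht => hed' t (one_pos.trans ht))
      (fun t _ => he0 t) (fun t ht => hyd t (one_pos.trans ht)) hyd'
      (fun t ht => hy0 t (one_pos.trans ht))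
  refine ⟨α, fun t ht => (hv t ht).memLp, fun t ht => ⟨2 * inner ℝ (V t) (Vt t),
    (hed' t ht).trans (neg_nonpos.2 (mul_nonneg (by positivity) (hy0 t ht))),
    (hed t ht).congr_of_eventuallyEq ?_⟩, ?_, fun q hq =>
    tendsto_eLpNorm_zero_of_uniform (f := v) (M := ENNReal.ofReal (e 1)) ENNReal.ofReal_ne_top
      ?_ (fun δ hδ => ?_) hq⟩
  · filter_upwards [Ioi_mem_nhds ht] with s hs
    exact (he s hs).symm
  · have := ENNReal.tendsto_ofReal hylim
    rw [ENNReal.ofReal_zero] at this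
    refine this.congr' ?_
    filter_upwards [eventually_gt_atTop 0] with t ht
    rw [hy t ht, ← eLpNorm_two_sq_eq (hv t ht).memLp_deriv, funext (hdv t ht)]
  · filter_upwards [eventually_gt_atTop 1] with t ht
    rw [lintegral_enorm_sq_eq (hv t (one_pos.trans ht)).memLp, ← he t (one_pos.trans ht)]
    exact ENNReal.ofReal_le_ofReal (hanti t ht)
  · have h1 : 0 < e 1 + 1 := by linarith [he0 1]
    -- This weight in Agmon's inequality keeps the L² part below δ²/2, leaving the other half for
    -- the decaying gradient. The 1 added to `e 1` avoids division by zero.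
    set ε := δ ^ 2 / (2 * (e 1 + 1)) with hεdef
    have hε : 0 < ε := by positivity
    filter_upwards [eventually_gt_atTop 1,
      hylim.eventually_lt_const (show 0 < ε * (δ ^ 2 / 2) by positivity)] with t ht hyt x
    have ht0 := one_pos.trans ht
    have hle := sq_le_mul_integral_sq_add (hv t ht0).contDiff (hv t ht0).memLp
      (hv t ht0).memLp_deriv hε x
    rw [← he t ht0, ← hy t ht0] at hle
    have h2 : ε * e t ≤ δ ^ 2 / 2 := by
      have h3 : ε * e t ≤ ε * (e 1 + 1) :=
        mul_le_mul_of_nonneg_left (by linarith [hanti t ht]) hε.le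
      have h4 : ε * (e 1 + 1) = δ ^ 2 / 2 := by
        rw [hεdef]; field_simp
      linarith
    have h5 : ε⁻¹ * y t ≤ δ ^ 2 / 2 := by
      rw [inv_mul_le_iff₀ hε]
      exact hyt.le
    exact abs_le_of_sq_le_sq (by linarith) hδ.le

end BurgersFront

end

theorem mainTheorem4 (ℓ : ℝ → ℂ) (hℓ_re : ∀ k : ℝ, (ℓ k).re ≤ 0) (hℓ_zero : ℓ 0 = 0)
    (φ : ℝ → ℝ) (hφ : BurgersFront.IsFront ℓ φ)
    (hφ_int : Integrable (fun x : ℝ => (1 + |x|) * deriv φ x) volume)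
    (h_sharp : BurgersFront.tau (fun x : ℝ => 1 / 2 * deriv φ x) < 1) :
    BurgersFront.IsAsymptoticallyStable ℓ φ :=
  hφ.isAsymptoticallyStable hℓ_re hφ_int h_sharp
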